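/- Let $\mathcal S,\mathcal U$ be finite sets (states and actions), let $p(j\mid i,u)$ be a controlled transition kernel on $\mathcal S$ ($p\ge 0$, $\sum_{j}p(j\mid i,u)=1$), and let $\Phi$ be a sampling policy with $\Phi(u\mid i)>0$ and $\sum_u\Phi(u\mid i)=1$ for all $i\in\mathcal S$. Assume that the stochastic matrix $P_\Phi(i,j)=\sum_{u}\Phi(u\mid i)\,p(j\mid i,u)$ is irreducible (this holds in particular if the controlled chain is irreducible under all control choices). Let $\gamma\in(0,1)$. For a cost $k:\mathcal S\times\mathcal U\to\mathbb R$ let $Q^*\in\mathbb R^{\mathcal S\times\mathcal U}$ be the unique solution of $$Q^*(i,u)=k(i,u)+\gamma\sum_{j\in\mathcal S}p(j\mid i,u)\min_{v\in\mathcal U}Q^*(j,v),\qquad i\in\mathcal S,\ u\in\mathcal U .$$ Let $(X_n,U_n)_{n\ge 0}$ be a trajectory under $\Phi$, and let $Q_0,\bar Q_0$ be random vectors in $\mathbb R^{\mathcal S\times\mathcal U}$ with finite second moments (for instance, deterministic). That is, for all $n\ge 0$, almost surely, $$\mathbb P(U_n=u\mid Q_0,\,X_m\ (m\le n),\,U_m\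 (m<n))=\Phi(u\mid X_n),\qquad \mathbb P(X_{n+1}=j\mid Q_0,\,X_m,U_m\ (m\le n))=p(j\mid X_n,U_n),$$ the law of $X_0$ being arbitrary. With $\alpha_n=\alpha_0/(n+1)$ and $\beta_n=\beta_0/(n+1)$, define, for $n\ge 0$, $$Q_{n+1}(i,u)=Q_n(i,u)+\alpha_n\,\mathbf 1\{X_n=i,U_n=u\}\Big(k(i,u)+\gamma\min_{v}Q_n(X_{n+1},v)-Q_n(i,u)\Big),$$ $$\bar Q_{n+1}(i,u)=\bar Q_n(i,u)+\beta_n\big(Q_n(i,u)-\bar Q_n(i,u)\big).$$ Then there exist a constant $C_4''>0$ and a time $n_0''$, depending only on $p,\Phi,\gamma$, such that for every cost $k$ and all $\alpha_0>0$ and $\beta_0\ge 8$ with $\beta_0/\alpha_0\le C_4''$, $$\mathbb E\big[\|\bar Q_n-Q^*\|_\infty^2\big]=\mathcal O\Big(\frac1{n+1}\Big)\qquad (n\ge n_0'').$$ More precisely, for every $R$ there is a constant $C$, depending only on $p,\Phi,\gamma,k,\alpha_0,\beta_0,R$, such that whenever $\mathbb E\|Q_0\|_\infty^2\le R$ and $\mathbb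 E\|\bar Q_0\|_\infty^2\le R$, one has $\mathbb E\|\bar Q_n-Q^*\|_\infty^2\le C/(n+1)$ for all $n\ge n_0''$ (and this expectation is finite). -/

import Mathlib

open MeasureTheory ProbabilityTheory

/-- A controlled transition kernel on a finite state space `S` with finite action space `U`:
`P.prob i u j` is the probability `p(j | i, u)` of moving to `j` when action `u` is used in `i`. -/
structure TransitionKernel (S U : Type*) [Fintype S] where
  prob : S → U → S → ℝ
  nonneg : ∀ i u j, 0 ≤ prob i u j
  sum_eq_one : ∀ i u, ∑ j, prob i u j = 1

/-- A stationary randomized policy charging every action: `Φ.prob i u` is `Φ(u | i) > 0`. -/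
structure SamplingPolicy (S U : Type*) [Fintype U] where
  prob : S → U → ℝ
  pos : ∀ i u, 0 < prob i u
  sum_eq_one : ∀ i, ∑ u, prob i u = 1

/-- Transition matrix of the state process when actions are drawn from the policy `Φ`. -/
def policyMatrix {S U : Type*} [Fintype S] [Fintype U] (P : TransitionKernel S U)
    (Φ : SamplingPolicy S U) : Matrix S S ℝ :=
  fun i j => ∑ u, Φ.prob i u * P.prob i u j

noncomputable section

/-- `min_v Q(j, v)`. -/
def minOverActions {S U : Type*} (Q : S × U → ℝ) (j : S) : ℝ := ⨅ v : U, Q (j, v)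

/-- The discounted optimality (Bellman) operator
`(T Q)(i, u) = k(i, u) + γ * ∑ j, p(j | i, u) * min_v Q(j, v)`. -/
def bellman {S U : Type*} [Fintype S] (P : TransitionKernel S U) (k : S × U → ℝ) (γ : ℝ)
    (Q : S × U → ℝ) : S × U → ℝ :=
  fun z => k z + γ * ∑ j, P.prob z.1 z.2 j * minOverActions Q j

theorem abs_minOverActions_sub_le {S U : Type*} [Fintype S] [Fintype U]
    (Q R : S × U → ℝ) (j : S) :
    |minOverActions Q j - minOverActions R j| ≤ dist Q R := by
  rcases isEmpty_or_nonempty U with hU | hU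
  · simp [minOverActions, dist_nonneg]
  have key : ∀ A B : S × U → ℝ, minOverActions A j - minOverActions B j ≤ dist A B := by
    intro A B
    rw [sub_le_iff_le_add', ← sub_le_iff_le_add]
    refine le_ciInf fun v => ?_
    have h1 : minOverActions A j ≤ A (j, v) :=
      ciInf_le (Set.finite_range fun v => A (j, v)).bddBelow v
    have h2 := dist_le_pi_dist A B (j, v)
    rw [Real.dist_eq] at h2
    linarith [le_abs_self (A (j, v) - B (j, v))]
  rw [abs_le]
  have h := key R Q
  rw [dist_comm] at h
  exact ⟨by linarith, key Q R⟩

theorem bellman_contracting {S U : Type*} [Fintype S] [Fintype U] (P : TransitionKernel S U)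
    (k : S × U → ℝ) {γ : ℝ} (hγ : γ ∈ Set.Ioo (0 : ℝ) 1) :
    ContractingWith ⟨γ, hγ.1.le⟩ (bellman P k γ) := by
  refine ⟨by exact_mod_cast hγ.2, LipschitzWith.of_dist_le_mul fun Q R => ?_⟩
  have h0 : 0 ≤ γ * dist Q R := mul_nonneg hγ.1.le dist_nonneg
  refine (dist_pi_le_iff h0).2 fun z => ?_
  have h1 : bellman P k γ Q z - bellman P k γ R z
      = γ * ∑ j, P.prob z.1 z.2 j * (minOverActions Q j - minOverActions R j) := by
    simp only [bellman, mul_sub, Finset.sum_sub_distrib]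
    ring
  rw [Real.dist_eq, h1, abs_mul, abs_of_pos hγ.1]
  refine mul_le_mul_of_nonneg_left ?_ hγ.1.le
  calc |∑ j, P.prob z.1 z.2 j * (minOverActions Q j - minOverActions R j)|
      ≤ ∑ j, |P.prob z.1 z.2 j * (minOverActions Q j - minOverActions R j)| :=
        Finset.abs_sum_le_sum_abs _ _
    _ ≤ ∑ j, P.prob z.1 z.2 j * dist Q R := by
        refine Finset.sum_le_sum fun j _ => ?_
        rw [abs_mul, abs_of_nonneg (P.nonneg _ _ _)]
        exact mul_le_mul_of_nonneg_left (abs_minOverActions_sub_le Q R j) (P.nonneg _ _ _)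
    _ = dist Q R := by rw [← Finset.sum_mul, P.sum_eq_one, one_mul]

/-- The optimal Q-vector `Q*`: the unique fixed point of the discounted optimality operator. -/
def optimalQ {S U : Type*} [Fintype S] [Fintype U] (P : TransitionKernel S U)
    (k : S × U → ℝ) (γ : ℝ) (hγ : γ ∈ Set.Ioo (0 : ℝ) 1) : S × U → ℝ :=
  ContractingWith.fixedPoint (bellman P k γ) (bellman_contracting P k hγ)

/-- `Q*(i, u) = k(i, u) + γ * ∑ j, p(j | i, u) * min_v Q*(j, v)`. -/
theorem optimalQ_eq {S U : Type*} [Fintype S] [Fintype U] (P : TransitionKernel S U)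
    (k : S × U → ℝ) (γ : ℝ) (hγ : γ ∈ Set.Ioo (0 : ℝ) 1) (i : S) (u : U) :
    optimalQ P k γ hγ (i, u)
      = k (i, u) + γ * ∑ j, P.prob i u j * ⨅ v : U, optimalQ P k γ hγ (j, v) :=
  (congrFun (bellman_contracting P k hγ).fixedPoint_isFixedPt (i, u)).symm

/-- Step size `c / (n + 1)`. -/
def stepSize (c : ℝ) (n : ℕ) : ℝ := c / ((n : ℝ) + 1)

/-- Asynchronous Q-learning with step sizes `α₀ / (n + 1)` along a state-action sequence
`(x n, u n)`: only the entry of the current state-action pair is updated. -/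
def qLearning {S U : Type*} [DecidableEq S] [DecidableEq U] (k : S × U → ℝ) (γ α₀ : ℝ)
    (x : ℕ → S) (u : ℕ → U) (q₀ : S × U → ℝ) : ℕ → S × U → ℝ
  | 0 => q₀
  | n + 1 => fun z =>
      qLearning k γ α₀ x u q₀ n z + stepSize α₀ n *
        (if x n = z.1 ∧ u n = z.2 then
          k z + γ * minOverActions (qLearning k γ α₀ x u q₀ n) (x (n + 1))
            - qLearning k γ α₀ x u q₀ n z
        else 0)

/-- Averaging of a sequence `q` with step sizes `β₀ / (n + 1)`. -/
def polyakAverage {ι : Type*} (β₀ : ℝ) (q : ℕ → ι → ℝ) (qbar₀ : ι → ℝ) : ℕ → ι → ℝ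
  | 0 => qbar₀
  | n + 1 => fun z =>
      polyakAverage β₀ q qbar₀ n z + stepSize β₀ n * (q n z - polyakAverage β₀ q qbar₀ n z)

/-- The averaged Q-learning iterate at time `n` as a random vector. -/
def averagedQ {Ω S U : Type*} [DecidableEq S] [DecidableEq U] (k : S × U → ℝ) (γ α₀ β₀ : ℝ)
    (X : ℕ → Ω → S) (A : ℕ → Ω → U) (Q₀ Qbar₀ : Ω → S × U → ℝ) (n : ℕ) (ω : Ω) : S × U → ℝ :=
  polyakAverage β₀ (qLearning k γ α₀ (fun m => X m ω) (fun m => A m ω) (Q₀ ω)) (Qbar₀ ω) n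

/-- The information available before the `n`-th action: the initial vector `Q₀`, the states
`X 0, …, X n` and the actions `A 0, …, A (n - 1)`. The iterates `Q 0, …, Q n` are functions of
these. -/
@[reducible] def historyBeforeAction {Ω S U : Type*} [MeasurableSpace S] [MeasurableSpace U]
    (X : ℕ → Ω → S) (A : ℕ → Ω → U) (Q₀ : Ω → S × U → ℝ) (n : ℕ) : MeasurableSpace Ω :=
  MeasurableSpace.comap Q₀ inferInstance
    ⊔ (⨆ m ∈ Set.Iic n, MeasurableSpace.comap (X m) inferInstance)
    ⊔ (⨆ m ∈ Set.Iio n, MeasurableSpace.comap (A m) inferInstance)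

/-- The information available after the `n`-th action. -/
@[reducible] def historyAfterAction {Ω S U : Type*} [MeasurableSpace S] [MeasurableSpace U]
    (X : ℕ → Ω → S) (A : ℕ → Ω → U) (Q₀ : Ω → S × U → ℝ) (n : ℕ) : MeasurableSpace Ω :=
  historyBeforeAction X A Q₀ n ⊔ MeasurableSpace.comap (A n) inferInstance

/-- `(X n, A n)` is a trajectory of the controlled chain `P` under the sampling policy `Φ`:
given the past, `A n` has law `Φ(· | X n)` and `X (n + 1)` has law `p(· | X n, A n)`. The law of
`X 0` is arbitrary. -/
structure IsSampleTrajectory {Ω S U : Type*} [MeasurableSpace Ω] [Fintype S] [Fintype U]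
    [MeasurableSpace S] [MeasurableSpace U] (μ : Measure Ω) (P : TransitionKernel S U)
    (Φ : SamplingPolicy S U) (X : ℕ → Ω → S) (A : ℕ → Ω → U) (Q₀ : Ω → S × U → ℝ) : Prop where
  measurable_state : ∀ n, Measurable (X n)
  measurable_action : ∀ n, Measurable (A n)
  measurable_init : Measurable Q₀
  action_law : ∀ n u,
    μ⟦A n ⁻¹' {u} | historyBeforeAction X A Q₀ n⟧ =ᵐ[μ] fun ω => Φ.prob (X n ω) u
  state_law : ∀ n j,
    μ⟦X (n + 1) ⁻¹' {j} | historyAfterAction X A Q₀ n⟧ =ᵐ[μ] fun ω => P.prob (X n ω) (A n ω) j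

end

/-! ### Foster–Lyapunov functions for visits to a state-action pair -/

section Drift

/-! With `C₄ = 8 / a` and `β₀ ≥ 8`, the ratio condition forces `α₀ ≥ a`, where `a` depends on `P`,
`Φ`, `γ` only. Averaging therefore has nothing to improve: with such large steps Q-learning itself
has mean-square error O(1/(n+1)) (`exists_qLearning_rate`), and convexity of the squared norm
carries this rate over to the averages (`exists_average_bound`).

For the rate of Q-learning there are two obstacles: the Bellman operator contracts only in the sup
norm, and each step moves only the visited coordinate. The Lyapunov function is ∑ Y_z^(2r+2), with Y
the scaled error. On an update of z, Young's inequality bounds the drift by -(2r+2)(1-γ) Y_z^(2r+2)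
+ ‖Y‖^(2r+2) (`even_power_drift_le`), and the second term is at most the Lyapunov function itself.
The gain grows with r and the loss does not, so a large r compensates for rare visits. Visits are
Markov-dependent; adding a multiple of α_n ∑ Y_z^(2r+2) f_z(X_n), with f_z from
`exists_visit_drift`, replaces the visit indicator by a constant frequency c > 0. The noise at Q* is
centred given the past and drops out in expectation. What remains (`exists_moment_step_bound`) is a
contraction with perturbation α_n^(r+2). Chung's lemma gives the rate (n+1)^(-(r+1)) for the moment
of order 2r+2, and the inequality t ≤ 1 + t^(r+1) brings this down to the second moment.

Only second moments of Q₀ are assumed, while moments of order 2r+2 are used. Hence the error is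
divided by 1 + ‖Q₀‖, which makes it bounded path by path (`exists_norm_scaledError_le`), and
expectations carry the weight (1 + ‖Q₀‖)², which restores exactly the square that was removed. -/

theorem exists_mulVec_eq_add_sub_sum {S : Type*} [Fintype S] [DecidableEq S]
    (T : Matrix S S ℝ) (v : S → ℝ) (L : ℕ) :
    ∃ g : S → ℝ, T.mulVec g = g + (L : ℝ) • v
      - ∑ l ∈ Finset.range L, (T ^ (l + 1)).mulVec v := by
  -- Applying T shifts the partial sum of T^l v, so only its two end terms survive; adding these
  -- identities for successive L produces `g`.
  have key : ∀ L : ℕ, T.mulVec (-∑ l ∈ Finset.range (L + 1), (T ^ l).mulVec v)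
      = -∑ l ∈ Finset.range (L + 1), (T ^ l).mulVec v + v - (T ^ (L + 1)).mulVec v := by
    intro L
    have h : T.mulVec (∑ l ∈ Finset.range (L + 1), (T ^ l).mulVec v)
        = ∑ l ∈ Finset.range (L + 1), (T ^ (l + 1)).mulVec v := by
      rw [Matrix.mulVec_sum]
      exact Finset.sum_congr rfl fun l _ => by rw [Matrix.mulVec_mulVec, pow_succ']
    have h2 : ∑ l ∈ Finset.range (L + 2), (T ^ l).mulVec v
        = ∑ l ∈ Finset.range (L + 1), (T ^ (l + 1)).mulVec v + v := by
      rw [Finset.sum_range_succ']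
      simp
    rw [Finset.sum_range_succ] at h2
    rw [Matrix.mulVec_neg, h, ← sub_eq_of_eq_add h2]
    abel
  induction L with
  | zero => exact ⟨0, by simp⟩
  | succ L ih =>
    obtain ⟨g, hg⟩ := ih
    refine ⟨g + -∑ l ∈ Finset.range (L + 1), (T ^ l).mulVec v, ?_⟩
    rw [Matrix.mulVec_add, hg, key, Finset.sum_range_succ _ L]
    push_cast
    rw [add_smul, one_smul, Finset.sum_range_succ (fun l => (T ^ (l + 1)).mulVec v)]
    abel

theorem exists_pos_forall_le {ι : Type*} [Finite ι] (φ : ι → ℝ) (h : ∀ i, 0 < φ i) :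
    ∃ c > 0, ∀ i, c ≤ φ i := by
  rcases isEmpty_or_nonempty ι with hι | hι
  · exact ⟨1, one_pos, fun i => (hι.false i).elim⟩
  · obtain ⟨i, hi⟩ := Finite.exists_min φ
    exact ⟨φ i, h i, hi⟩

/-- A Foster–Lyapunov function for the visits of an irreducible stochastic matrix to a state. -/
theorem exists_drift_function {S : Type*} [Fintype S] [DecidableEq S] (T : Matrix S S ℝ)
    (hT : T.IsIrreducible) (hsum : ∀ i, ∑ j, T i j = 1) (i₀ : S) :
    ∃ c > 0, ∃ f : S → ℝ, (∀ i, 0 ≤ f i) ∧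
      ∀ i, ∑ j, T i j * f j ≤ f i + (if i = i₀ then 1 else 0) - c := by
  have hpow : ∀ l i j, 0 ≤ (T ^ l) i j := by
    intro l
    induction l with
    | zero => intro i j; rw [pow_zero, Matrix.one_apply]; split_ifs <;> norm_num
    | succ l ih =>
      intro i j
      rw [pow_succ, Matrix.mul_apply]
      exact Finset.sum_nonneg fun x _ => mul_nonneg (ih i x) (hT.nonneg x j)
  choose m hm0 hm using fun i => (Matrix.isIrreducible_iff_exists_pow_pos hT.nonneg).1 hT i i₀
  obtain ⟨L, hL⟩ : ∃ L : ℕ, ∀ i, m i ≤ L :=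
    ⟨∑ i, m i, fun i => Finset.single_le_sum (f := m) (fun _ _ => Nat.zero_le _)
      (Finset.mem_univ i)⟩
  have hLpos : (0 : ℝ) < L := by exact_mod_cast (hm0 i₀).trans_le (hL i₀)
  set v : S → ℝ := Pi.single i₀ 1
  have hv : ∀ l i, (T ^ l).mulVec v i = (T ^ l) i i₀ := fun l i => by
    simp [v]
  obtain ⟨g, hg⟩ := exists_mulVec_eq_add_sub_sum T v L
  -- From every state, `i₀` is reached with positive probability at some time between 1 and L.
  -- Summing over these times makes aperiodicity unnecessary.
  obtain ⟨c, hc, hcle⟩ := exists_pos_forall_le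
    (fun i => ∑ l ∈ Finset.range L, (T ^ (l + 1)) i i₀) (fun i => by
      refine Finset.sum_pos' (fun l _ => hpow _ _ _) ⟨m i - 1, ?_, ?_⟩
      · have := hm0 i; have := hL i
        simp only [Finset.mem_range]; omega
      · rw [Nat.sub_add_cancel (hm0 i)]; exact hm i)
  have hgi : ∀ i, ∑ j, T i j * g j ≤ g i + L * (if i = i₀ then 1 else 0) - c := by
    intro i
    have h := congrFun hg i
    simp only [Pi.add_apply, Pi.sub_apply, Pi.smul_apply, smul_eq_mul, Finset.sum_apply, hv] at h
    have h1 : T.mulVec g i = ∑ j, T i j * g j := rfl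
    have h2 : v i = if i = i₀ then 1 else 0 := by simp [v, Pi.single_apply]
    rw [← h1, h, h2]
    linarith [hcle i]
  -- Division by L normalizes the visit term to 1. The added constant gives nonnegativity and does
  -- not affect the drift, since the rows of T sum to 1.
  refine ⟨c / L, div_pos hc hLpos, fun i => g i / L + ∑ j, |g j / L|, fun i => ?_, fun i => ?_⟩
  · have := Finset.single_le_sum (f := fun j => |g j / L|) (fun _ _ => abs_nonneg _)
      (Finset.mem_univ i)
    have h2 := neg_abs_le (g i / L)
    linarith
  · simp only [mul_add, Finset.sum_add_distrib, ← Finset.sum_mul, hsum, one_mul]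
    have h := div_le_div_of_nonneg_right (hgi i) hLpos.le
    rw [Finset.sum_div, sub_div, add_div, mul_div_cancel_left₀ _ hLpos.ne'] at h
    simp only [mul_div_assoc] at h ⊢
    linarith

theorem policyMatrix_row_sum {S U : Type*} [Fintype S] [Fintype U] (P : TransitionKernel S U)
    (Φ : SamplingPolicy S U) (i : S) : ∑ j, policyMatrix P Φ i j = 1 := by
  unfold policyMatrix
  rw [Finset.sum_comm]
  simp only [← Finset.mul_sum, P.sum_eq_one, mul_one, Φ.sum_eq_one]

/-- Scaling the function for the state `z.1` by Φ(z.2 | z.1) turns the visit indicator of the state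
into the conditional probability of visiting the pair. Finiteness allows one `c` for all pairs. -/
theorem exists_visit_drift {S U : Type*} [Fintype S] [Fintype U] [DecidableEq S]
    (P : TransitionKernel S U) (Φ : SamplingPolicy S U)
    (hirr : (policyMatrix P Φ).IsIrreducible) :
    ∃ c > 0, ∃ f : S × U → S → ℝ, (∀ z i, 0 ≤ f z i) ∧
      ∀ z i, ∑ j, policyMatrix P Φ i j * f z j
        ≤ f z i + (if i = z.1 then Φ.prob z.1 z.2 else 0) - c := by
  choose c hc f hf0 hf using exists_drift_function _ hirr (policyMatrix_row_sum P Φ)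
  obtain ⟨c', hc', hle⟩ := exists_pos_forall_le
    (fun z : S × U => Φ.prob z.1 z.2 * c z.1) (fun z => mul_pos (Φ.pos _ _) (hc _))
  refine ⟨c', hc', fun z i => Φ.prob z.1 z.2 * f z.1 i,
    fun z i => mul_nonneg (Φ.pos _ _).le (hf0 _ _), fun z i => ?_⟩
  have h := mul_le_mul_of_nonneg_left (hf z.1 i) (Φ.pos z.1 z.2).le
  rw [Finset.mul_sum] at h
  calc _ = ∑ j, Φ.prob z.1 z.2 * (policyMatrix P Φ i j * f z.1 j) :=
        Finset.sum_congr rfl fun j _ => by ring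
    _ ≤ _ := h
    _ ≤ _ := by
      have := hle z
      split_ifs <;> simp only [mul_sub, mul_add, mul_one, mul_zero] <;> linarith

end Drift

/-! ### One-step bounds for even powers of a coordinate -/

section OneStep

/-- Taylor remainder, by induction on multiplication by x + t. The factor (|x| + |t|)^n is kept
because it is small when the error is small, which the final rate needs. -/
theorem abs_add_pow_sub_sub_le (n : ℕ) (x t : ℝ) :
    |(x + t) ^ (n + 2) - x ^ (n + 2) - (n + 2) * x ^ (n + 1) * t|
      ≤ ((n : ℝ) + 2) ^ 2 * t ^ 2 * (|x| + |t|) ^ n := by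
  induction n with
  | zero =>
    have : (x + t) ^ (0 + 2) - x ^ (0 + 2) - ((0 : ℕ) + 2) * x ^ (0 + 1) * t = t ^ 2 := by
      push_cast; ring
    rw [this, abs_of_nonneg (sq_nonneg t)]
    push_cast
    nlinarith [sq_nonneg t]
  | succ n ih =>
    have h : (x + t) ^ (n + 1 + 2) - x ^ (n + 1 + 2)
          - (((n + 1 : ℕ) : ℝ) + 2) * x ^ (n + 1 + 1) * t
        = (x + t) * ((x + t) ^ (n + 2) - x ^ (n + 2) - (n + 2) * x ^ (n + 1) * t)
          + (n + 2) * x ^ (n + 1) * t ^ 2 := by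
      push_cast; ring
    rw [h]
    have hs : 0 ≤ |x| + |t| := by positivity
    have hx : |x| ^ (n + 1) ≤ (|x| + |t|) ^ (n + 1) :=
      pow_le_pow_left₀ (abs_nonneg _) (by linarith [abs_nonneg t]) _
    have hn : (0 : ℝ) ≤ n := n.cast_nonneg
    calc _ ≤ (|x| + |t|) * (((n : ℝ) + 2) ^ 2 * t ^ 2 * (|x| + |t|) ^ n)
          + (n + 2) * (|x| + |t|) ^ (n + 1) * t ^ 2 := by
          refine (abs_add_le _ _).trans (add_le_add ?_ ?_)
          · rw [abs_mul]
            exact mul_le_mul (abs_add_le _ _) ih (abs_nonneg _) hs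
          · rw [abs_mul, abs_mul, abs_of_nonneg (sq_nonneg t),
              abs_of_nonneg (by positivity : (0 : ℝ) ≤ n + 2), abs_pow]
            gcongr
      _ = (((n : ℝ) + 2) ^ 2 + (n + 2)) * t ^ 2 * (|x| + |t|) ^ (n + 1) := by ring
      _ ≤ _ := by
          push_cast
          gcongr
          nlinarith

/-- Young's inequality with integer exponents; the induction step uses that M^(n+1) - y^(n+1) and M
- y have the same sign. -/
theorem mul_pow_mul_le_pow_add (n : ℕ) {y M : ℝ} (hy : 0 ≤ y) (hM : 0 ≤ M) :
    ((n : ℝ) + 1) * y ^ n * M ≤ M ^ (n + 1) + n * y ^ (n + 1) := by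
  induction n with
  | zero => simp
  | succ n ih =>
    have h1 := mul_le_mul_of_nonneg_left ih hy
    have h2 : 0 ≤ (M ^ (n + 1) - y ^ (n + 1)) * (M - y) := by
      rcases le_total y M with h | h
      · exact mul_nonneg (sub_nonneg.2 (pow_le_pow_left₀ hy h _)) (sub_nonneg.2 h)
      · exact mul_nonneg_of_nonpos_of_nonpos (sub_nonpos.2 (pow_le_pow_left₀ hM h _))
          (sub_nonpos.2 h)
    push_cast
    ring_nf at h1 h2 ⊢
    linarith

/-- Trades a mixed error (step size times ‖Y‖^(2r)) for ‖Y‖^(2r+2), which the contraction absorbs,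
plus a pure power of the step size. -/
theorem mul_pow_le_pow_succ_add (r : ℕ) {t m : ℝ} (ht : 0 ≤ t) (hm : 0 ≤ m) :
    t * m ^ r ≤ m ^ (r + 1) + t ^ (r + 1) := by
  rcases le_total t m with h | h
  · have : t * m ^ r ≤ m * m ^ r := by gcongr
    have : 0 ≤ t ^ (r + 1) := by positivity
    rw [pow_succ' m]; linarith
  · have : t * m ^ r ≤ t * t ^ r := by gcongr
    have : 0 ≤ m ^ (r + 1) := by positivity
    rw [pow_succ' t]; linarith

/-- Young's inequality splits the cross term y^(2r+1) γ g. The point is that M^(2r+2) comes out with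
coefficient 1, independent of r, while the contraction has the factor 2r+2. -/
theorem even_power_drift_le (r : ℕ) {γ : ℝ} (hγ : γ ∈ Set.Ioo (0 : ℝ) 1) {y g M : ℝ} (ν : ℝ)
    (hy : |y| ≤ M) (hg : |g| ≤ M) :
    (2 * r + 2) * y ^ (2 * r + 1) * (γ * g + ν - y)
      ≤ -((2 * r + 2) * (1 - γ)) * y ^ (2 * r + 2) + M ^ (2 * r + 2)
        + (2 * r + 2) * y ^ (2 * r + 1) * ν := by
  have hM : 0 ≤ M := (abs_nonneg y).trans hy
  have hyoung := mul_pow_mul_le_pow_add (2 * r + 1) (abs_nonneg y) hM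
  have hyp : |y| ^ (2 * r + 1 + 1) = y ^ (2 * r + 2) := by
    rw [show 2 * r + 1 + 1 = 2 * (r + 1) by ring, pow_mul, sq_abs, ← pow_mul]
  have hcross : y ^ (2 * r + 1) * (γ * g) ≤ γ * (|y| ^ (2 * r + 1) * M) := by
    calc y ^ (2 * r + 1) * (γ * g) ≤ |y ^ (2 * r + 1) * (γ * g)| := le_abs_self _
      _ = γ * (|y| ^ (2 * r + 1) * |g|) := by
        rw [abs_mul, abs_mul, abs_of_pos hγ.1, abs_pow]; ring
      _ ≤ _ := by have := hγ.1; gcongr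
  have hMp : 0 ≤ M ^ (2 * r + 2) := by positivity
  have hyp0 : 0 ≤ y ^ (2 * r + 2) := by
    rw [← hyp]; positivity
  rw [hyp] at hyoung
  push_cast at hyoung
  have e1 : (2 * r + 2) * y ^ (2 * r + 1) * (γ * g + ν - y)
      = (2 * r + 2) * (y ^ (2 * r + 1) * (γ * g)) + (2 * r + 2) * y ^ (2 * r + 1) * ν
        - (2 * r + 2) * y ^ (2 * r + 2) := by ring
  have e2 : (2 * (r : ℝ) + 2) * (y ^ (2 * r + 1) * (γ * g))
      ≤ (2 * r + 2) * (γ * (|y| ^ (2 * r + 1) * M)) := by gcongr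
  have e3 : γ * ((2 * (r : ℝ) + 1 + 1) * |y| ^ (2 * r + 1) * M)
      ≤ γ * (M ^ (2 * r + 2) + (2 * r + 1) * y ^ (2 * r + 2)) :=
    mul_le_mul_of_nonneg_left hyoung hγ.1.le
  have e4 : γ * M ^ (2 * r + 2) ≤ M ^ (2 * r + 2) := mul_le_of_le_one_left hMp hγ.2.le
  have e5 : 0 ≤ γ * y ^ (2 * r + 2) := mul_nonneg hγ.1.le hyp0
  have e6 : (2 * (r : ℝ) + 2) * (γ * (|y| ^ (2 * r + 1) * M))
      = γ * ((2 * (r : ℝ) + 1 + 1) * |y| ^ (2 * r + 1) * M) := by ring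
  have e7 : γ * (M ^ (2 * r + 2) + (2 * r + 1) * y ^ (2 * r + 2))
      = γ * M ^ (2 * r + 2) + (2 * r + 2) * (γ * y ^ (2 * r + 2))
        - γ * y ^ (2 * r + 2) := by ring
  have e8 : -((2 * r + 2) * (1 - γ)) * y ^ (2 * r + 2)
      = -((2 * r + 2) * y ^ (2 * r + 2)) + (2 * r + 2) * (γ * y ^ (2 * r + 2)) := by ring
  rw [e1, e8]
  linarith

/-- Effect of one stochastic-approximation step on an even power of a coordinate: an upper bound
with a contracting drift and a martingale term, and a first-order bound. -/
theorem exists_even_power_step_bound (r : ℕ) {γ : ℝ} (hγ : γ ∈ Set.Ioo (0 : ℝ) 1)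
    {B c₀ α₀ : ℝ} (hB : 0 ≤ B) (hc₀ : 0 ≤ c₀) (hα₀ : 0 ≤ α₀) :
    ∃ C : ℝ, 0 ≤ C ∧ ∀ y g ν M α : ℝ, |y| ≤ M → M ≤ B → |g| ≤ M → |ν| ≤ c₀ → 0 ≤ α → α ≤ α₀ →
      (y + α * (γ * g + ν - y)) ^ (2 * r + 2)
          ≤ y ^ (2 * r + 2) - α * ((2 * r + 2) * (1 - γ)) * y ^ (2 * r + 2)
            + α * M ^ (2 * r + 2) + α * ((2 * r + 2) * y ^ (2 * r + 1) * ν)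
            + C * α ^ 2 * (M ^ (2 * r) + α ^ (2 * r)) ∧
      (y + α * (γ * g + ν - y)) ^ (2 * r + 2)
          ≤ y ^ (2 * r + 2) + C * α * (M ^ (2 * r) + α ^ (2 * r)) := by
  -- A bound for the increment γg + ν - y; the extra 1 makes X ≥ 1, so powers of X may be inserted
  -- freely.
  set X : ℝ := 2 * B + c₀ + 1 with hX
  have hX1 : 1 ≤ X := by linarith
  set K : ℝ := 2 ^ (2 * r) * X ^ (2 * r) with hK
  have hK0 : 0 ≤ K := by positivity
  set C₁ : ℝ := (2 * r + 2) ^ 2 * X ^ 2 * K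
  set C₂ : ℝ := (2 * r + 2) * X * (B + α₀ * X) * K
  have hC₁ : 0 ≤ C₁ := by positivity
  have hC₂ : 0 ≤ C₂ := by positivity
  refine ⟨C₁ + C₂, by positivity, fun y g ν M α hy hMB hg hν hα hαα₀ => ?_⟩
  have hM : 0 ≤ M := (abs_nonneg y).trans hy
  set ξ : ℝ := γ * g + ν - y with hξ
  have hξX : |ξ| ≤ X := by
    have h1 : |γ * g| ≤ M := by
      rw [abs_mul, abs_of_pos hγ.1]
      nlinarith [abs_nonneg g, hγ.2, hγ.1]
    have h2 : |ξ| ≤ |γ * g| + |ν| + |y| := by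
      rw [hξ]
      exact (abs_sub _ _).trans (by linarith [abs_add_le (γ * g) ν])
    linarith
  have hE0 : 0 ≤ M ^ (2 * r) + α ^ (2 * r) := by positivity
  have hαξ : |α * ξ| ≤ α * X := by
    rw [abs_mul, abs_of_nonneg hα]; gcongr
  have hsum : |y| + |α * ξ| ≤ M + α * X := add_le_add hy hαξ
  have hpow : (|y| + |α * ξ|) ^ (2 * r) ≤ K * (M ^ (2 * r) + α ^ (2 * r)) := by
    calc (|y| + |α * ξ|) ^ (2 * r) ≤ (M + α * X) ^ (2 * r) := by gcongr
      _ ≤ 2 ^ (2 * r - 1) * (M ^ (2 * r) + (α * X) ^ (2 * r)) := add_pow_le hM (by positivity) _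
      _ ≤ 2 ^ (2 * r) * (X ^ (2 * r) * M ^ (2 * r) + X ^ (2 * r) * α ^ (2 * r)) := by
          have h1 : (2 : ℝ) ^ (2 * r - 1) ≤ 2 ^ (2 * r) :=
            pow_le_pow_right₀ (by norm_num) (Nat.sub_le _ _)
          have h2 : M ^ (2 * r) ≤ X ^ (2 * r) * M ^ (2 * r) :=
            le_mul_of_one_le_left (by positivity) (one_le_pow₀ hX1)
          rw [mul_pow α X, mul_comm (α ^ (2 * r)) (X ^ (2 * r))]
          gcongr
      _ = K * (M ^ (2 * r) + α ^ (2 * r)) := by rw [hK]; ring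
  constructor
  · have h := (abs_le.1 (abs_add_pow_sub_sub_le (2 * r) y (α * ξ))).2
    have hq : ((2 * r : ℕ) + 2 : ℝ) ^ 2 * (α * ξ) ^ 2 * (|y| + |α * ξ|) ^ (2 * r)
        ≤ C₁ * α ^ 2 * (M ^ (2 * r) + α ^ (2 * r)) := by
      have h1 : (α * ξ) ^ 2 ≤ α ^ 2 * X ^ 2 := by
        rw [← sq_abs, ← mul_pow]; gcongr
      calc _ ≤ ((2 * r : ℕ) + 2 : ℝ) ^ 2 * (α ^ 2 * X ^ 2)
            * (K * (M ^ (2 * r) + α ^ (2 * r))) := by gcongr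
        _ = _ := by push_cast; ring
    have hC : C₁ * α ^ 2 * (M ^ (2 * r) + α ^ (2 * r))
        ≤ (C₁ + C₂) * α ^ 2 * (M ^ (2 * r) + α ^ (2 * r)) := by
      gcongr; linarith
    have hmain := even_power_drift_le r hγ ν hy hg
    rw [← hξ] at hmain
    push_cast at h hq
    have hfin := mul_le_mul_of_nonneg_left hmain hα
    calc _ ≤ y ^ (2 * r + 2) + α * ((2 * r + 2) * y ^ (2 * r + 1) * ξ)
          + (C₁ + C₂) * α ^ 2 * (M ^ (2 * r) + α ^ (2 * r)) := by
          have : (2 * (r : ℝ) + 2) * y ^ (2 * r + 1) * (α * ξ)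
            = α * ((2 * r + 2) * y ^ (2 * r + 1) * ξ) := by ring
          linarith
      _ ≤ _ := by linarith
  -- The mean-value bound has 2r+1 factors; one is bounded by B + α₀X so that the others give the
  -- same error shape as in the first estimate.
  · have h := abs_pow_sub_pow_le (y + α * ξ) y (2 * r + 2)
    have h1 : max |y + α * ξ| |y| ≤ |y| + |α * ξ| :=
      max_le (abs_add_le _ _) (by linarith [abs_nonneg (α * ξ)])
    have h2 : |y| + |α * ξ| ≤ B + α₀ * X := hsum.trans (by gcongr)
    have h3 : max |y + α * ξ| |y| ^ (2 * r + 2 - 1)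
        ≤ (B + α₀ * X) * (K * (M ^ (2 * r) + α ^ (2 * r))) := by
      calc max |y + α * ξ| |y| ^ (2 * r + 2 - 1) ≤ (|y| + |α * ξ|) ^ (2 * r + 1) := by
            rw [show 2 * r + 2 - 1 = 2 * r + 1 by omega]
            exact pow_le_pow_left₀ (le_max_of_le_right (abs_nonneg _)) h1 _
        _ = (|y| + |α * ξ|) * (|y| + |α * ξ|) ^ (2 * r) := pow_succ' _ _
        _ ≤ _ := mul_le_mul h2 hpow (by positivity) (by positivity)
    have h4 : |(y + α * ξ) ^ (2 * r + 2) - y ^ (2 * r + 2)|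
        ≤ α * X * (2 * r + 2) * ((B + α₀ * X) * (K * (M ^ (2 * r) + α ^ (2 * r)))) := by
      refine h.trans (mul_le_mul ?_ h3 (by positivity) (by positivity))
      rw [add_sub_cancel_left]
      push_cast
      gcongr
    have h5 : α * X * (2 * r + 2) * ((B + α₀ * X) * (K * (M ^ (2 * r) + α ^ (2 * r))))
        = C₂ * α * (M ^ (2 * r) + α ^ (2 * r)) := by ring
    have h6 : C₂ * α * (M ^ (2 * r) + α ^ (2 * r))
        ≤ (C₁ + C₂) * α * (M ^ (2 * r) + α ^ (2 * r)) := by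
      gcongr; linarith
    linarith [le_abs_self ((y + α * ξ) ^ (2 * r + 2) - y ^ (2 * r + 2))]

end OneStep

/-! ### The drift-corrected Lyapunov function along one update -/

section Lyapunov

theorem norm_pow_le_sum_pow {ι : Type*} [Fintype ι] [Nonempty ι] (r : ℕ) (Y : ι → ℝ) :
    ‖Y‖ ^ (2 * r + 2) ≤ ∑ z, Y z ^ (2 * r + 2) := by
  obtain ⟨z, hz⟩ := Finite.exists_max fun z => ‖Y z‖
  have h1 : ‖Y‖ ≤ ‖Y z‖ := (pi_norm_le_iff_of_nonneg (norm_nonneg _)).2 hz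
  have hev : Even (2 * r + 2) := ⟨r + 1, by ring⟩
  calc ‖Y‖ ^ (2 * r + 2) ≤ ‖Y z‖ ^ (2 * r + 2) := by gcongr
    _ = Y z ^ (2 * r + 2) := by rw [Real.norm_eq_abs, hev.pow_abs]
    _ ≤ _ := Finset.single_le_sum (f := fun z => Y z ^ (2 * r + 2))
      (fun z _ => hev.pow_nonneg _) (Finset.mem_univ z)

/-- One asynchronous step changes the drift-corrected even-power Lyapunov function by a contracting
term, a martingale term and a higher-order error. -/
theorem exists_lyapunov_step_bound (ι : Type*) [Fintype ι] [DecidableEq ι] (r : ℕ) {γ : ℝ}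
    (hγ : γ ∈ Set.Ioo (0 : ℝ) 1) {B c₀ α₀ K : ℝ} (hB : 0 ≤ B) (hc₀ : 0 ≤ c₀) (hα₀ : 0 ≤ α₀)
    (hK : 0 ≤ K) :
    ∃ C : ℝ, 0 ≤ C ∧ ∀ (Y Y' ν φ : ι → ℝ) (g α : ℝ) (z₀ : ι), ‖Y‖ ≤ B → |g| ≤ ‖Y‖ →
      (∀ z, |ν z| ≤ c₀) → (∀ z, 0 ≤ φ z) → (∀ z, φ z ≤ K) → 0 ≤ α → α ≤ α₀ →
      (∀ z, Y' z = Y z + α * (if z = z₀ then γ * g + ν z - Y z else 0)) →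
      ∑ z, Y' z ^ (2 * r + 2) + (2 * r + 2) * (1 - γ) * α * ∑ z, Y' z ^ (2 * r + 2) * φ z
        ≤ ∑ z, Y z ^ (2 * r + 2) + 2 * α * ∑ z, Y z ^ (2 * r + 2)
          - (2 * r + 2) * (1 - γ) * α * ∑ z, Y z ^ (2 * r + 2) * (if z = z₀ then 1 else 0)
          + (2 * r + 2) * α * ∑ z, Y z ^ (2 * r + 1) * (if z = z₀ then ν z else 0)
          + (2 * r + 2) * (1 - γ) * α * ∑ z, Y z ^ (2 * r + 2) * φ z
          + C * α ^ (r + 2) := by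
  obtain ⟨C₁, hC₁, H⟩ := exists_even_power_step_bound r hγ hB hc₀ hα₀
  set b : ℝ := (2 * r + 2) * (1 - γ)
  have hb : 0 ≤ b := mul_nonneg (by positivity) (by linarith [hγ.2])
  set C₂ : ℝ := Fintype.card ι * (C₁ * (1 + b * K))
  have hC₂ : 0 ≤ C₂ := by positivity
  refine ⟨C₂ ^ (r + 1) + C₂ * α₀ ^ r, by positivity, ?_⟩
  intro Y Y' ν φ g α z₀ hYB hg hν hφ0 hφK hα hαα₀ hY'
  have hne : Nonempty ι := ⟨z₀⟩
  set M := ‖Y‖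
  have hM : 0 ≤ M := norm_nonneg _
  set E := M ^ (2 * r) + α ^ (2 * r)
  have hE : 0 ≤ E := by positivity
  have hev : Even (2 * r + 2) := ⟨r + 1, by ring⟩
  have hz : ∀ z, Y' z ^ (2 * r + 2) + b * α * (Y' z ^ (2 * r + 2) * φ z)
      ≤ Y z ^ (2 * r + 2) - b * α * (Y z ^ (2 * r + 2) * (if z = z₀ then 1 else 0))
        + α * (if z = z₀ then M ^ (2 * r + 2) else 0)
        + (2 * r + 2) * α * (Y z ^ (2 * r + 1) * (if z = z₀ then ν z else 0))
        + b * α * (Y z ^ (2 * r + 2) * φ z) + C₁ * (1 + b * K) * α ^ 2 * E := by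
    intro z
    have hbα : 0 ≤ b * α := by positivity
    obtain ⟨h1, h2⟩ := H (Y z) g (ν z) M α (norm_le_pi_norm Y z) hYB hg (hν z) hα hαα₀
    rw [hY' z]
    by_cases h : z = z₀
    · simp only [h, if_true, mul_one] at h1 h2 ⊢
      have h3 := mul_le_mul_of_nonneg_right h2 (hφ0 z₀)
      have h4 : C₁ * α * E * φ z₀ ≤ C₁ * α * E * K :=
        mul_le_mul_of_nonneg_left (hφK z₀) (by positivity)
      rw [add_mul] at h3
      have h5 := mul_le_mul_of_nonneg_left (h3.trans (add_le_add_right h4 _)) hbα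
      have h6 : C₁ * (1 + b * K) * α ^ 2 * E
          = C₁ * α ^ 2 * E + b * α * (C₁ * α * E * K) := by ring
      rw [h6]
      rw [mul_add (b * α)] at h5
      linarith
    · simp only [h, if_false, mul_zero, add_zero, sub_zero]
      have : 0 ≤ C₁ * (1 + b * K) * α ^ 2 * E := by positivity
      linarith
  have hsum := Finset.sum_le_sum fun z (_ : z ∈ Finset.univ) => hz z
  simp only [Finset.sum_add_distrib, Finset.sum_sub_distrib, ← Finset.mul_sum] at hsum
  rw [Finset.sum_ite_eq' Finset.univ z₀, if_pos (Finset.mem_univ _), Finset.sum_const,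
    Finset.card_univ, nsmul_eq_mul] at hsum
  have hMG := norm_pow_le_sum_pow r Y
  -- The quadratic error costs one more α M^(2r+2). With the one from the update of `z₀`, this is
  -- the coefficient 2 in the statement.
  have herr : (Fintype.card ι : ℝ) * (C₁ * (1 + b * K) * α ^ 2 * E)
      ≤ α * M ^ (2 * r + 2) + (C₂ ^ (r + 1) + C₂ * α₀ ^ r) * α ^ (r + 2) := by
    have e1 : (Fintype.card ι : ℝ) * (C₁ * (1 + b * K) * α ^ 2 * E)
        = α * ((C₂ * α) * (M ^ 2) ^ r) + C₂ * (α ^ r * α ^ (r + 2)) := by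
      simp only [C₂, E]; ring
    have e2 := mul_pow_le_pow_succ_add r (mul_nonneg hC₂ hα) (sq_nonneg M)
    have e3 : α ^ r ≤ α₀ ^ r := by gcongr
    have e4 : C₂ * (α ^ r * α ^ (r + 2)) ≤ C₂ * (α₀ ^ r * α ^ (r + 2)) := by gcongr
    have e5 := mul_le_mul_of_nonneg_left e2 hα
    have e6 : α * ((M ^ 2) ^ (r + 1) + (C₂ * α) ^ (r + 1))
        = α * M ^ (2 * r + 2) + C₂ ^ (r + 1) * α ^ (r + 2) := by ring_nf
    rw [e1]
    rw [e6] at e5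
    linarith
  have hMG' := mul_le_mul_of_nonneg_left hMG hα
  linarith

end Lyapunov

/-! ### Pathwise structure and boundedness of the scaled error -/

section Path

variable {S U : Type*} [Fintype S] [Fintype U]

/-- The one-step noise of Q-learning at the optimal Q-vector. -/
noncomputable def bellmanNoise (P : TransitionKernel S U) (k : S × U → ℝ) (γ : ℝ)
    (hγ : γ ∈ Set.Ioo (0 : ℝ) 1) (z : S × U) (j : S) : ℝ :=
  k z + γ * minOverActions (optimalQ P k γ hγ) j - optimalQ P k γ hγ z

theorem sum_prob_mul_bellmanNoise (P : TransitionKernel S U) (k : S × U → ℝ) (γ : ℝ)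
    (hγ : γ ∈ Set.Ioo (0 : ℝ) 1) (z : S × U) :
    ∑ j, P.prob z.1 z.2 j * bellmanNoise P k γ hγ z j = 0 := by
  have h := optimalQ_eq P k γ hγ z.1 z.2
  have h2 : ∀ j, P.prob z.1 z.2 j * bellmanNoise P k γ hγ z j
      = P.prob z.1 z.2 j * (k z - optimalQ P k γ hγ z)
        + γ * (P.prob z.1 z.2 j * minOverActions (optimalQ P k γ hγ) j) := fun j => by
    unfold bellmanNoise; ring
  simp only [h2, Finset.sum_add_distrib, ← Finset.sum_mul, ← Finset.mul_sum, P.sum_eq_one]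
  simp only [minOverActions]
  simp only [Prod.mk.eta] at h
  linarith

theorem exists_abs_bellmanNoise_le (P : TransitionKernel S U) (k : S × U → ℝ) (γ : ℝ)
    (hγ : γ ∈ Set.Ioo (0 : ℝ) 1) : ∃ c : ℝ, 0 ≤ c ∧ ∀ z j, |bellmanNoise P k γ hγ z j| ≤ c := by
  refine ⟨∑ z, ∑ j, |bellmanNoise P k γ hγ z j|,
    Finset.sum_nonneg fun _ _ => Finset.sum_nonneg fun _ _ => abs_nonneg _, fun z j => ?_⟩
  exact (Finset.single_le_sum (f := fun j => |bellmanNoise P k γ hγ z j|)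
    (fun _ _ => abs_nonneg _) (Finset.mem_univ j)).trans
    (Finset.single_le_sum (f := fun z => ∑ j, |bellmanNoise P k γ hγ z j|)
      (fun _ _ => Finset.sum_nonneg fun _ _ => abs_nonneg _) (Finset.mem_univ z))

variable [DecidableEq S] [DecidableEq U]

/-- The Q-learning error relative to the size of the initial vector. -/
noncomputable def scaledError (P : TransitionKernel S U) (k : S × U → ℝ) (γ : ℝ)
    (hγ : γ ∈ Set.Ioo (0 : ℝ) 1) (α₀ : ℝ) (x : ℕ → S) (u : ℕ → U) (q₀ : S × U → ℝ) (n : ℕ) :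
    S × U → ℝ :=
  (1 + ‖q₀‖)⁻¹ • (qLearning k γ α₀ x u q₀ n - optimalQ P k γ hγ)

/-- Subtracting Q* splits the update into contraction and noise: `g` is the scaled difference of the
two minima at the next state, controlled because the minimum is 1-Lipschitz in the sup norm. -/
theorem scaledError_succ (P : TransitionKernel S U) (k : S × U → ℝ) (γ : ℝ)
    (hγ : γ ∈ Set.Ioo (0 : ℝ) 1) (α₀ : ℝ) (x : ℕ → S) (u : ℕ → U) (q₀ : S × U → ℝ) (n : ℕ) :
    ∃ g : ℝ, |g| ≤ ‖scaledError P k γ hγ α₀ x u q₀ n‖ ∧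
      ∀ z, scaledError P k γ hγ α₀ x u q₀ (n + 1) z = scaledError P k γ hγ α₀ x u q₀ n z
        + stepSize α₀ n * (if z = (x n, u n) then
          γ * g + (1 + ‖q₀‖)⁻¹ * bellmanNoise P k γ hγ z (x (n + 1))
            - scaledError P k γ hγ α₀ x u q₀ n z else 0) := by
  have hs : 0 < (1 + ‖q₀‖)⁻¹ := by positivity
  refine ⟨(1 + ‖q₀‖)⁻¹ * (minOverActions (qLearning k γ α₀ x u q₀ n) (x (n + 1))
    - minOverActions (optimalQ P k γ hγ) (x (n + 1))), ?_, fun z => ?_⟩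
  · rw [abs_mul, abs_of_pos hs, scaledError, norm_smul, Real.norm_eq_abs, abs_of_pos hs,
      ← dist_eq_norm]
    exact mul_le_mul_of_nonneg_left (abs_minOverActions_sub_le _ _ _) hs.le
  · have hiff : (x n = z.1 ∧ u n = z.2) ↔ z = (x n, u n) := by
      rw [Prod.ext_iff]; exact and_congr eq_comm eq_comm
    simp only [scaledError, qLearning, Pi.smul_apply, Pi.sub_apply, smul_eq_mul, hiff]
    split_ifs
    · unfold bellmanNoise; ring
    · ring

theorem stepSize_nonneg {c : ℝ} (hc : 0 ≤ c) (n : ℕ) : 0 ≤ stepSize c n := by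
  unfold stepSize; positivity

theorem stepSize_le {c : ℝ} (hc : 0 ≤ c) (n : ℕ) : stepSize c n ≤ c := by
  unfold stepSize
  exact div_le_self hc (by linarith [n.cast_nonneg (α := ℝ)])

theorem stepSize_le_of_le {c d : ℝ} (hd : 0 < d) {n : ℕ} (h : c / d ≤ n) :
    stepSize c n ≤ d := by
  unfold stepSize
  rw [div_le_iff₀ hd] at h
  rw [div_le_iff₀ (by positivity)]
  linarith

/-- The scaling bounds the initial error and does not enlarge the noise. Finitely many early steps,
possibly longer than 1, inflate the bound by fixed factors and terms; afterwards each update is a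
convex combination, and a ball of radius B with γB + c ≤ B is invariant. -/
theorem exists_norm_scaledError_le (P : TransitionKernel S U) (k : S × U → ℝ) (γ : ℝ)
    (hγ : γ ∈ Set.Ioo (0 : ℝ) 1) {α₀ : ℝ} (hα₀ : 0 ≤ α₀) :
    ∃ B : ℝ, 0 ≤ B ∧ ∀ (x : ℕ → S) (u : ℕ → U) (q₀ : S × U → ℝ) (n : ℕ),
      ‖scaledError P k γ hγ α₀ x u q₀ n‖ ≤ B := by
  obtain ⟨c, hc, hν⟩ := exists_abs_bellmanNoise_le P k γ hγ
  have hν' : ∀ (q₀ : S × U → ℝ) z j, |(1 + ‖q₀‖)⁻¹ * bellmanNoise P k γ hγ z j| ≤ c := by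
    intro q₀ z j
    rw [abs_mul, abs_of_pos (by positivity)]
    exact (mul_le_of_le_one_left (abs_nonneg _)
      (inv_le_one_of_one_le₀ (by linarith [norm_nonneg q₀]))).trans (hν z j)
  have hearly : ∀ n, ∃ B : ℝ, 0 ≤ B ∧ ∀ (x : ℕ → S) (u : ℕ → U) (q₀ : S × U → ℝ), ∀ m ≤ n,
      ‖scaledError P k γ hγ α₀ x u q₀ m‖ ≤ B := by
    intro n
    induction n with
    | zero =>
      refine ⟨1 + ‖optimalQ P k γ hγ‖, by positivity, fun x u q₀ m hm => ?_⟩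
      obtain rfl : m = 0 := by omega
      have hs : (0 : ℝ) < 1 + ‖q₀‖ := by positivity
      rw [scaledError, norm_smul, Real.norm_eq_abs, abs_of_pos (by positivity),
        inv_mul_le_iff₀ hs]
      refine (norm_sub_le _ _).trans ?_
      simp only [qLearning]
      nlinarith [norm_nonneg q₀, norm_nonneg (optimalQ P k γ hγ)]
    | succ n ih =>
      obtain ⟨B, hB, h⟩ := ih
      refine ⟨B + α₀ * (2 * B + c), by positivity, fun x u q₀ m hm => ?_⟩
      have hle : B ≤ B + α₀ * (2 * B + c) := by
        have : 0 ≤ α₀ * (2 * B + c) := by positivity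
        linarith
      rcases Nat.lt_or_ge n m with hlt | hge
      · obtain rfl : m = n + 1 := by omega
        obtain ⟨g, hg, hrec⟩ := scaledError_succ P k γ hγ α₀ x u q₀ n
        have hn := h x u q₀ n le_rfl
        refine (pi_norm_le_iff_of_nonneg (by positivity)).2 fun z => ?_
        rw [hrec z]
        have hz := (norm_le_pi_norm _ z).trans hn
        refine (norm_add_le _ _).trans (add_le_add hz ?_)
        rw [norm_mul, Real.norm_eq_abs, abs_of_nonneg (stepSize_nonneg hα₀ n)]
        refine mul_le_mul (stepSize_le hα₀ n) ?_ (norm_nonneg _) hα₀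
        split_ifs
        · have h1 : ‖γ * g‖ ≤ B := by
            rw [norm_mul, Real.norm_eq_abs, Real.norm_eq_abs, abs_of_pos hγ.1]
            exact (mul_le_of_le_one_left (abs_nonneg _) hγ.2.le).trans (hg.trans hn)
          have h2 : ‖(1 + ‖q₀‖)⁻¹ * bellmanNoise P k γ hγ z (x (n + 1))‖ ≤ c := hν' _ _ _
          refine (norm_sub_le _ _).trans ?_
          linarith [norm_add_le (γ * g) ((1 + ‖q₀‖)⁻¹ * bellmanNoise P k γ hγ z (x (n + 1)))]
        · rw [norm_zero]; positivity
      · exact (h x u q₀ m hge).trans hle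
  obtain ⟨N, hN⟩ := exists_nat_ge (α₀ / 1)
  obtain ⟨B₀, hB₀, h⟩ := hearly N
  have h1γ : 0 < 1 - γ := by linarith [hγ.2]
  refine ⟨max B₀ (c / (1 - γ)), le_max_of_le_left hB₀, fun x u q₀ n => ?_⟩
  rcases le_total n N with hn | hn
  · exact (h x u q₀ n hn).trans (le_max_left _ _)
  induction n, hn using Nat.le_induction with
  | base => exact (h x u q₀ N le_rfl).trans (le_max_left _ _)
  | succ n hNn ih =>
    set B := max B₀ (c / (1 - γ))
    have hB : 0 ≤ B := le_max_of_le_left hB₀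
    have hcB : c ≤ (1 - γ) * B := by
      have : c / (1 - γ) ≤ B := le_max_right _ _
      rwa [div_le_iff₀' h1γ] at this
    have hα1 : stepSize α₀ n ≤ 1 :=
      stepSize_le_of_le one_pos (hN.trans (by exact_mod_cast hNn))
    have hα := stepSize_nonneg hα₀ n
    obtain ⟨g, hg, hrec⟩ := scaledError_succ P k γ hγ α₀ x u q₀ n
    refine (pi_norm_le_iff_of_nonneg hB).2 fun z => ?_
    rw [hrec z]
    have hz := (norm_le_pi_norm _ z).trans ih
    split_ifs
    · generalize stepSize α₀ n = α at *
      generalize scaledError P k γ hγ α₀ x u q₀ n z = y at *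
      have h2 := hν' q₀ z (x (n + 1))
      generalize (1 + ‖q₀‖)⁻¹ * bellmanNoise P k γ hγ z (x (n + 1)) = ν at *
      rw [show y + α * (γ * g + ν - y) = (1 - α) * y + α * (γ * g + ν) by ring]
      have h1 : |γ * g| ≤ γ * B := by
        rw [abs_mul, abs_of_pos hγ.1]
        exact mul_le_mul_of_nonneg_left (hg.trans ih) hγ.1.le
      have h3 : |γ * g + ν| ≤ B := (abs_add_le _ _).trans (by linarith)
      calc ‖(1 - α) * y + α * (γ * g + ν)‖ ≤ (1 - α) * B + α * B := by
            refine (norm_add_le _ _).trans (add_le_add ?_ ?_)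
            · rw [norm_mul, Real.norm_eq_abs, abs_of_nonneg (by linarith)]
              exact mul_le_mul_of_nonneg_left hz (by linarith)
            · rw [norm_mul, Real.norm_eq_abs, abs_of_nonneg hα]
              exact mul_le_mul_of_nonneg_left h3 hα
        _ = B := by ring
    · rw [mul_zero, add_zero]; exact hz

end Path

/-! ### Integrals against the conditional laws of actions and next states -/

section Conditioning

theorem integral_mul_indicator_of_condExp {Ω : Type*} {m mΩ : MeasurableSpace Ω} {μ : Measure Ω}
    [IsFiniteMeasure μ] (hm : m ≤ mΩ) {s : Set Ω} (hs : MeasurableSet s) {F g : Ω → ℝ}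
    (hF : StronglyMeasurable[m] F) (hFi : Integrable F μ) (hg : μ⟦s | m⟧ =ᵐ[μ] g) :
    ∫ ω, F ω * s.indicator (fun _ => (1 : ℝ)) ω ∂μ = ∫ ω, F ω * g ω ∂μ := by
  have hind : Integrable (s.indicator (fun _ => (1 : ℝ))) μ :=
    (integrable_const (1 : ℝ)).indicator hs
  have hprod : Integrable (F * s.indicator (fun _ => (1 : ℝ))) μ := by
    have : F * s.indicator (fun _ => (1 : ℝ)) = s.indicator F := by
      ext ω
      by_cases h : ω ∈ s <;> simp [h]
    rw [this]
    exact hFi.indicator hs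
  have h1 := condExp_mul_of_stronglyMeasurable_left hF hprod hind
  calc _ = ∫ ω, (F * s.indicator (fun _ => (1 : ℝ))) ω ∂μ := rfl
    _ = ∫ ω, (μ[F * s.indicator (fun _ => (1 : ℝ)) | m]) ω ∂μ := (integral_condExp hm).symm
    _ = _ := by
      refine integral_congr_ae ?_
      filter_upwards [h1, hg] with ω h2 h3
      rw [h2, Pi.mul_apply, h3]

end Conditioning

section History

variable {Ω S U : Type*} [MeasurableSpace S] [MeasurableSpace U]
  {X : ℕ → Ω → S} {A : ℕ → Ω → U} {Q₀ : Ω → S × U → ℝ}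

theorem IsSampleTrajectory.measurable_init_history (n : ℕ) : Measurable[historyBeforeAction X A Q₀ n] Q₀ :=
  (comap_measurable Q₀).mono (le_sup_left.trans le_sup_left) le_rfl

theorem IsSampleTrajectory.measurable_state_history {m n : ℕ} (hmn : m ≤ n) :
    Measurable[historyBeforeAction X A Q₀ n] (X m) :=
  (comap_measurable (X m)).mono
    (((le_iSup₂ (f := fun m (_ : m ∈ Set.Iic n) => MeasurableSpace.comap (X m) inferInstance)
      m hmn).trans le_sup_right).trans le_sup_left) le_rfl

theorem IsSampleTrajectory.measurable_action_history {m n : ℕ} (hmn : m < n) :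
    Measurable[historyBeforeAction X A Q₀ n] (A m) :=
  (comap_measurable (A m)).mono
    ((le_iSup₂ (f := fun m (_ : m ∈ Set.Iio n) => MeasurableSpace.comap (A m) inferInstance)
      m hmn).trans le_sup_right) le_rfl

theorem IsSampleTrajectory.measurable_action_historyAfterAction (n : ℕ) :
    Measurable[historyAfterAction X A Q₀ n] (A n) :=
  (comap_measurable (A n)).mono le_sup_right le_rfl

end History

namespace IsSampleTrajectory

variable {Ω S U : Type*} [mΩ : MeasurableSpace Ω] [Fintype S] [Fintype U]
  [MeasurableSpace S] [MeasurableSpace U]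
  {μ : Measure Ω} {P : TransitionKernel S U}
  {Φ : SamplingPolicy S U} {X : ℕ → Ω → S} {A : ℕ → Ω → U} {Q₀ : Ω → S × U → ℝ}

theorem historyBeforeAction_le (h : IsSampleTrajectory μ P Φ X A Q₀) (n : ℕ) :
    historyBeforeAction X A Q₀ n ≤ mΩ :=
  sup_le (sup_le h.measurable_init.comap_le
    (iSup₂_le fun m _ => (h.measurable_state m).comap_le))
    (iSup₂_le fun m _ => (h.measurable_action m).comap_le)

theorem historyAfterAction_le (h : IsSampleTrajectory μ P Φ X A Q₀) (n : ℕ) :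
    historyAfterAction X A Q₀ n ≤ mΩ :=
  sup_le (h.historyBeforeAction_le n) (h.measurable_action n).comap_le

variable [MeasurableSingletonClass S] [MeasurableSingletonClass U] [IsFiniteMeasure μ]

/-- Expansion of f(X_{n+1}) in indicators of the finitely many states reduces the Markov property to
the assumed conditional probabilities. -/
theorem integral_mul_next_state (h : IsSampleTrajectory μ P Φ X A Q₀) (n : ℕ) {F : Ω → ℝ}
    (hF : Measurable[historyAfterAction X A Q₀ n] F) (hFi : Integrable F μ) (f : S → ℝ) :
    ∫ ω, F ω * f (X (n + 1) ω) ∂μ = ∫ ω, F ω * ∑ j, P.prob (X n ω) (A n ω) j * f j ∂μ := by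
  classical
  have hset : ∀ j, MeasurableSet (X (n + 1) ⁻¹' {j}) := fun j =>
    h.measurable_state (n + 1) (measurableSet_singleton j)
  have hP : Measurable fun ω => (X n ω, A n ω) :=
    (h.measurable_state n).prodMk (h.measurable_action n)
  have hint : ∀ j, Integrable (fun ω => F ω * P.prob (X n ω) (A n ω) j) μ := by
    intro j
    refine hFi.mul_bdd (c := 1)
      ((measurable_of_countable fun z : S × U => P.prob z.1 z.2 j).comp hP).aestronglyMeasurable
      (Filter.Eventually.of_forall fun ω => ?_)
    rw [Real.norm_eq_abs, abs_of_nonneg (P.nonneg _ _ _),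
      ← P.sum_eq_one (X n ω) (A n ω)]
    exact Finset.single_le_sum (f := fun j => P.prob (X n ω) (A n ω) j)
      (fun _ _ => P.nonneg _ _ _) (Finset.mem_univ j)
  have hint' : ∀ j, Integrable
      (fun ω => F ω * (X (n + 1) ⁻¹' {j}).indicator (fun _ => (1 : ℝ)) ω) μ := by
    intro j
    refine (hFi.indicator (hset j)).congr (Filter.Eventually.of_forall fun ω => ?_)
    by_cases hω : ω ∈ X (n + 1) ⁻¹' {j}
    · simp only [Set.indicator_of_mem hω, mul_one]
    · simp only [Set.indicator_of_notMem hω, mul_zero]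
  calc _ = ∫ ω, ∑ j, F ω * (X (n + 1) ⁻¹' {j}).indicator (fun _ => (1 : ℝ)) ω * f j ∂μ := by
        refine integral_congr_ae (Filter.Eventually.of_forall fun ω => ?_)
        simp [Set.indicator_apply]
    _ = ∑ j, (∫ ω, F ω * (X (n + 1) ⁻¹' {j}).indicator (fun _ => (1 : ℝ)) ω ∂μ) * f j := by
        rw [integral_finsetSum _ fun j _ => (hint' j).mul_const _]
        simp only [integral_mul_const]
    _ = ∑ j, (∫ ω, F ω * P.prob (X n ω) (A n ω) j ∂μ) * f j := by
        refine Finset.sum_congr rfl fun j _ => ?_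
        rw [integral_mul_indicator_of_condExp (h.historyAfterAction_le n) (hset j)
          hF.stronglyMeasurable hFi (h.state_law n j)]
    _ = _ := by
        simp only [← integral_mul_const]
        rw [← integral_finsetSum _ fun j _ => (hint j).mul_const _]
        simp only [Finset.mul_sum, mul_assoc]

theorem integral_mul_action (h : IsSampleTrajectory μ P Φ X A Q₀) (n : ℕ) {F : Ω → ℝ}
    (hF : Measurable[historyBeforeAction X A Q₀ n] F) (hFi : Integrable F μ) (f : S → U → ℝ) :
    ∫ ω, F ω * f (X n ω) (A n ω) ∂μ
      = ∫ ω, F ω * ∑ u, Φ.prob (X n ω) u * f (X n ω) u ∂μ := by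
  classical
  have hset : ∀ u, MeasurableSet (A n ⁻¹' {u}) := fun u =>
    h.measurable_action n (measurableSet_singleton u)
  have hG : ∀ u, Measurable[historyBeforeAction X A Q₀ n] fun ω => F ω * f (X n ω) u := fun u =>
    hF.mul ((measurable_of_countable fun i => f i u).comp (measurable_state_history le_rfl))
  have hbd : ∀ g : S → ℝ, Integrable (fun ω => g (X n ω)) μ ∧
      ∀ G : Ω → ℝ, Integrable G μ → Integrable (fun ω => G ω * g (X n ω)) μ := by
    intro g
    have hm : AEStronglyMeasurable (fun ω => g (X n ω)) μ :=
      ((measurable_of_countable g).comp (h.measurable_state n)).aestronglyMeasurable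
    have hb : ∀ᵐ ω ∂μ, ‖g (X n ω)‖ ≤ ∑ i, ‖g i‖ := Filter.Eventually.of_forall fun ω =>
      Finset.single_le_sum (f := fun i => ‖g i‖) (fun _ _ => norm_nonneg _)
        (Finset.mem_univ (X n ω))
    exact ⟨Integrable.of_bound hm _ hb, fun G hG => hG.mul_bdd hm hb⟩
  have hGi : ∀ u, Integrable (fun ω => F ω * f (X n ω) u) μ := fun u =>
    (hbd fun i => f i u).2 F hFi
  have hint' : ∀ u, Integrable
      (fun ω => F ω * f (X n ω) u * (A n ⁻¹' {u}).indicator (fun _ => (1 : ℝ)) ω) μ := by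
    intro u
    refine ((hGi u).indicator (hset u)).congr (Filter.Eventually.of_forall fun ω => ?_)
    by_cases hω : ω ∈ A n ⁻¹' {u}
    · simp only [Set.indicator_of_mem hω, mul_one]
    · simp only [Set.indicator_of_notMem hω, mul_zero]
  calc _ = ∫ ω, ∑ u, F ω * f (X n ω) u
          * (A n ⁻¹' {u}).indicator (fun _ => (1 : ℝ)) ω ∂μ := by
        refine integral_congr_ae (Filter.Eventually.of_forall fun ω => ?_)
        simp [Set.indicator_apply]
    _ = ∑ u, ∫ ω, F ω * f (X n ω) u * Φ.prob (X n ω) u ∂μ := by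
        rw [integral_finsetSum _ fun u _ => hint' u]
        exact Finset.sum_congr rfl fun u _ =>
          integral_mul_indicator_of_condExp (h.historyBeforeAction_le n) (hset u)
            (hG u).stronglyMeasurable (hGi u) (h.action_law n u)
    _ = _ := by
        rw [← integral_finsetSum _ fun u _ => (hbd fun i => Φ.prob i u).2 _ (hGi u)]
        refine integral_congr_ae (Filter.Eventually.of_forall fun ω => ?_)
        simp only [Finset.mul_sum]
        exact Finset.sum_congr rfl fun u _ => by ring

end IsSampleTrajectory

/-! ### Measurability of the iterates -/

section Measurability

theorem measurable_minOverActions {Ω S U : Type*} {m : MeasurableSpace Ω} [Fintype S] [Fintype U]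
    [MeasurableSpace S] [MeasurableSingletonClass S] {q : Ω → S × U → ℝ} {x : Ω → S}
    (hq : Measurable q) (hx : Measurable x) :
    Measurable fun ω => minOverActions (q ω) (x ω) := by
  have h : Measurable fun y : (S × U → ℝ) × S => minOverActions y.1 y.2 :=
    measurable_from_prod_countable_left fun j => Measurable.iInf fun v => measurable_pi_apply (j, v)
  exact h.comp (hq.prodMk hx)

/-- The σ-algebra is arbitrary and only X_0, …, X_n and A_0, …, A_{n-1} enter, so that this serves
both for the ambient σ-algebra and for `historyBeforeAction`. -/
theorem measurable_qLearning {Ω S U : Type*} {m : MeasurableSpace Ω} [Fintype S] [Fintype U]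
    [DecidableEq S] [DecidableEq U] [MeasurableSpace S] [MeasurableSingletonClass S]
    [MeasurableSpace U] [MeasurableSingletonClass U] (k : S × U → ℝ) (γ α₀ : ℝ)
    {X : ℕ → Ω → S} {A : ℕ → Ω → U} {Q₀ : Ω → S × U → ℝ} (hQ : Measurable Q₀) (n : ℕ)
    (hX : ∀ m ≤ n, Measurable (X m)) (hA : ∀ m < n, Measurable (A m)) :
    Measurable fun ω => qLearning k γ α₀ (fun m => X m ω) (fun m => A m ω) (Q₀ ω) n := by
  induction n with
  | zero => exact hQ
  | succ n ih =>
    have hq := ih (fun m hm => hX m (by omega)) (fun m hm => hA m (by omega))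
    refine measurable_pi_lambda _ fun z => ?_
    have hz := (measurable_pi_apply z).comp hq
    refine hz.add (Measurable.const_mul (Measurable.ite ?_ ?_ measurable_const) _)
    · exact (hX n (by omega) (measurableSet_singleton z.1)).inter
        (hA n (by omega) (measurableSet_singleton z.2))
    · exact (((measurable_minOverActions hq (hX (n + 1) le_rfl)).const_mul γ).const_add _).sub hz

theorem measurable_scaledError {Ω S U : Type*} {m : MeasurableSpace Ω} [Fintype S] [Fintype U]
    [DecidableEq S] [DecidableEq U] [MeasurableSpace S] [MeasurableSingletonClass S]
    [MeasurableSpace U] [MeasurableSingletonClass U] (P : TransitionKernel S U) (k : S × U → ℝ)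
    (γ : ℝ) (hγ : γ ∈ Set.Ioo (0 : ℝ) 1) (α₀ : ℝ)
    {X : ℕ → Ω → S} {A : ℕ → Ω → U} {Q₀ : Ω → S × U → ℝ} (hQ : Measurable Q₀) (n : ℕ)
    (hX : ∀ m ≤ n, Measurable (X m)) (hA : ∀ m < n, Measurable (A m)) :
    Measurable fun ω =>
      scaledError P k γ hγ α₀ (fun m => X m ω) (fun m => A m ω) (Q₀ ω) n := by
  unfold scaledError
  exact (hQ.norm.const_add 1).inv.smul ((measurable_qLearning k γ α₀ hQ n hX hA).sub_const _)

theorem measurable_one_add_norm_sq {Ω E : Type*} {m : MeasurableSpace Ω} [NormedAddCommGroup E]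
    [MeasurableSpace E] [OpensMeasurableSpace E] {Q : Ω → E} (hQ : Measurable Q) :
    Measurable fun ω => (1 + ‖Q ω‖) ^ 2 :=
  (hQ.norm.const_add 1).pow_const 2

theorem measurable_one_add_norm_inv {Ω E : Type*} {m : MeasurableSpace Ω} [NormedAddCommGroup E]
    [MeasurableSpace E] [OpensMeasurableSpace E] {Q : Ω → E} (hQ : Measurable Q) :
    Measurable fun ω => (1 + ‖Q ω‖)⁻¹ :=
  (hQ.norm.const_add 1).inv

end Measurability

/-! ### Bounded measurable factors, for integrability against the weight -/

section BoundedMeasurable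

/-- A measurable function with values in a bounded set of reals. -/
structure IsBddMeasurable {Ω : Type*} [MeasurableSpace Ω] (h : Ω → ℝ) : Prop where
  measurable : Measurable h
  bdd : ∃ C, ∀ ω, |h ω| ≤ C

namespace IsBddMeasurable

variable {Ω : Type*} [MeasurableSpace Ω] {h g : Ω → ℝ}

theorem mul (hh : IsBddMeasurable h) (hg : IsBddMeasurable g) :
    IsBddMeasurable fun ω => h ω * g ω := by
  obtain ⟨C, hC⟩ := hh.bdd
  obtain ⟨D, hD⟩ := hg.bdd
  refine ⟨hh.measurable.mul hg.measurable, C * D, fun ω => ?_⟩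
  rw [abs_mul]
  exact mul_le_mul (hC ω) (hD ω) (abs_nonneg _) ((abs_nonneg _).trans (hC ω))

theorem pow (hh : IsBddMeasurable h) (n : ℕ) : IsBddMeasurable fun ω => h ω ^ n := by
  obtain ⟨C, hC⟩ := hh.bdd
  refine ⟨hh.measurable.pow_const n, C ^ n, fun ω => ?_⟩
  rw [abs_pow]
  exact pow_le_pow_left₀ (abs_nonneg _) (hC ω) n

theorem sum {ι : Type*} (s : Finset ι) {h : ι → Ω → ℝ} (hh : ∀ i, IsBddMeasurable (h i)) :
    IsBddMeasurable fun ω => ∑ i ∈ s, h i ω := by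
  choose C hC using fun i => (hh i).bdd
  exact ⟨Finset.measurable_fun_sum s fun i _ => (hh i).measurable, ∑ i ∈ s, C i, fun ω =>
    (Finset.abs_sum_le_sum_abs _ _).trans (Finset.sum_le_sum fun i _ => hC i ω)⟩

theorem of_finite {α : Type*} [Finite α] [MeasurableSpace α] [MeasurableSingletonClass α]
    {x : Ω → α} (hx : Measurable x) (f : α → ℝ) : IsBddMeasurable fun ω => f (x ω) := by
  obtain ⟨C, hC⟩ := (Set.finite_range fun a => |f a|).bddAbove
  exact ⟨(measurable_of_countable f).comp hx, C, fun ω => hC ⟨x ω, rfl⟩⟩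

theorem integrable_mul {μ : Measure Ω} {W : Ω → ℝ} (hh : IsBddMeasurable h)
    (hW : Integrable W μ) : Integrable (fun ω => W ω * h ω) μ := by
  obtain ⟨C, hC⟩ := hh.bdd
  exact hW.mul_bdd hh.measurable.aestronglyMeasurable (Filter.Eventually.of_forall hC)

end IsBddMeasurable

end BoundedMeasurable

/-! ### Weighted moments; visit drift and centred noise in expectation -/

section Moments

theorem memLp_two_integrable_weight {Ω E : Type*} [MeasurableSpace Ω] [NormedAddCommGroup E]
    {μ : Measure Ω} [IsFiniteMeasure μ] {Q : Ω → E} (hQ : MemLp Q 2 μ) :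
    Integrable (fun ω => (1 + ‖Q ω‖) ^ 2) μ :=
  ((memLp_const (1 : ℝ)).add hQ.norm).integrable_sq

variable {Ω S U : Type*} [Fintype S] [Fintype U] [DecidableEq S] [DecidableEq U]

/-- The scaled Q-learning error along a random trajectory. -/
noncomputable def errorProcess (P : TransitionKernel S U) (k : S × U → ℝ) (γ : ℝ)
    (hγ : γ ∈ Set.Ioo (0 : ℝ) 1) (α₀ : ℝ) (X : ℕ → Ω → S) (A : ℕ → Ω → U)
    (Q₀ : Ω → S × U → ℝ) (n : ℕ) (ω : Ω) : S × U → ℝ :=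
  scaledError P k γ hγ α₀ (fun m => X m ω) (fun m => A m ω) (Q₀ ω) n

/-- The weighted moment of order `2r + 2` of a random vector. -/
noncomputable def weightedMoment [MeasurableSpace Ω] (μ : Measure Ω) {ι : Type*} [Fintype ι]
    (W : Ω → ℝ) (r : ℕ) (Y : Ω → ι → ℝ) : ℝ :=
  ∫ ω, W ω * ∑ z, Y ω z ^ (2 * r + 2) ∂μ

/-- The weighted moment of order `2r + 2` with coordinates weighted by functions of a state. -/
noncomputable def weightedDrift [MeasurableSpace Ω] (μ : Measure Ω) {ι : Type*} [Fintype ι]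
    (W : Ω → ℝ) (r : ℕ) (Y : Ω → ι → ℝ) (f : ι → S → ℝ) (x : Ω → S) : ℝ :=
  ∫ ω, W ω * ∑ z, Y ω z ^ (2 * r + 2) * f z (x ω) ∂μ

variable [MeasurableSpace S] [MeasurableSingletonClass S] [MeasurableSpace U]
  [MeasurableSingletonClass U]

section Trajectory

variable [MeasurableSpace Ω] {μ : Measure Ω} [IsFiniteMeasure μ] {P : TransitionKernel S U}
  {Φ : SamplingPolicy S U} {X : ℕ → Ω → S} {A : ℕ → Ω → U} {Q₀ : Ω → S × U → ℝ}

/-- Averaged visits of `z` dominate up to a telescoping term. -/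
theorem IsSampleTrajectory.integral_mul_drift_le (h : IsSampleTrajectory μ P Φ X A Q₀) (n : ℕ)
    {c : ℝ} {z : S × U} {f : S → ℝ}
    (hf : ∀ i, ∑ j, policyMatrix P Φ i j * f j
      ≤ f i + (if i = z.1 then Φ.prob z.1 z.2 else 0) - c)
    {F : Ω → ℝ} (hF : Measurable[historyBeforeAction X A Q₀ n] F) (hFi : Integrable F μ)
    (hF0 : ∀ ω, 0 ≤ F ω) :
    ∫ ω, F ω * f (X (n + 1) ω) ∂μ
      ≤ ∫ ω, F ω * f (X n ω) ∂μ
        + ∫ ω, F ω * (if z = (X n ω, A n ω) then 1 else 0) ∂μ - c * ∫ ω, F ω ∂μ := by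
  have hFa : Measurable[historyAfterAction X A Q₀ n] F := hF.mono le_sup_left le_rfl
  have hi : ∀ g : S → ℝ, Integrable (fun ω => F ω * g (X n ω)) μ := fun g =>
    (IsBddMeasurable.of_finite (h.measurable_state n) g).integrable_mul hFi
  -- F is known before the action is drawn, so the visit indicator averages to the term in the drift
  -- condition `hf`.
  have hvis : ∫ ω, F ω * (if z = (X n ω, A n ω) then 1 else 0) ∂μ
      = ∫ ω, F ω * (if X n ω = z.1 then Φ.prob z.1 z.2 else 0) ∂μ := by
    rw [h.integral_mul_action n hF hFi fun i u => if z = (i, u) then 1 else 0]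
    refine integral_congr_ae (Filter.Eventually.of_forall fun ω => ?_)
    simp only [Prod.ext_iff, mul_ite, mul_one, mul_zero]
    by_cases hx : X n ω = z.1
    · simp [hx]
    · simp [hx, Ne.symm hx]
  have hpol : ∀ i, ∑ u, Φ.prob i u * ∑ j, P.prob i u j * f j
      = ∑ j, policyMatrix P Φ i j * f j := by
    intro i
    simp only [policyMatrix, Finset.sum_mul, Finset.mul_sum]
    rw [Finset.sum_comm]
    simp only [mul_assoc]
  have hadd : Integrable (fun ω => F ω * f (X n ω)
      + F ω * (if X n ω = z.1 then Φ.prob z.1 z.2 else 0)) μ :=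
    (hi f).add (hi fun i => if i = z.1 then Φ.prob z.1 z.2 else 0)
  rw [h.integral_mul_next_state n hFa hFi f,
    h.integral_mul_action n hF hFi fun i u => ∑ j, P.prob i u j * f j, hvis,
    ← integral_add (hi f) (hi fun i => if i = z.1 then Φ.prob z.1 z.2 else 0),
    ← integral_const_mul, ← integral_sub hadd (hFi.const_mul c)]
  simp only [hpol]
  refine integral_mono (hi fun i => ∑ j, policyMatrix P Φ i j * f j)
    (hadd.sub (hFi.const_mul c)) fun ω => ?_
  have := mul_le_mul_of_nonneg_left (hf (X n ω)) (hF0 ω)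
  simp only [mul_sub, mul_add] at this
  linarith

/-- Given the history after the action, the visit indicator is known and only the next state is
random; the Bellman equation at Q* says that the noise has mean zero under p(· | z). -/
theorem IsSampleTrajectory.integral_mul_noise_eq_zero (h : IsSampleTrajectory μ P Φ X A Q₀)
    (n : ℕ) (k : S × U → ℝ) (γ : ℝ) (hγ : γ ∈ Set.Ioo (0 : ℝ) 1) (z : S × U)
    {F : Ω → ℝ} (hF : Measurable[historyBeforeAction X A Q₀ n] F) (hFi : Integrable F μ) :
    ∫ ω, F ω * (if z = (X n ω, A n ω) then bellmanNoise P k γ hγ z (X (n + 1) ω) else 0) ∂μ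
      = 0 := by
  have hZ : Measurable[historyAfterAction X A Q₀ n] fun ω => (X n ω, A n ω) :=
    ((measurable_state_history le_rfl).mono le_sup_left le_rfl).prodMk
      (measurable_action_historyAfterAction n)
  have hFa : Measurable[historyAfterAction X A Q₀ n] fun ω =>
      F ω * (if z = (X n ω, A n ω) then (1 : ℝ) else 0) :=
    (hF.mono le_sup_left le_rfl).mul
      ((measurable_of_countable fun y : S × U => if z = y then (1 : ℝ) else 0).comp hZ)
  have hFai : Integrable (fun ω => F ω * (if z = (X n ω, A n ω) then (1 : ℝ) else 0)) μ :=
    (IsBddMeasurable.of_finite (hZ.mono (h.historyAfterAction_le n) le_rfl)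
      fun y : S × U => if z = y then (1 : ℝ) else 0).integrable_mul hFi
  have h1 := h.integral_mul_next_state n hFa hFai (bellmanNoise P k γ hγ z)
  calc _ = ∫ ω, F ω * (if z = (X n ω, A n ω) then (1 : ℝ) else 0)
        * bellmanNoise P k γ hγ z (X (n + 1) ω) ∂μ := by
        refine integral_congr_ae (Filter.Eventually.of_forall fun ω => ?_)
        simp only
        split_ifs <;> ring
    _ = _ := h1
    _ = 0 := by
        rw [← integral_zero Ω ℝ (μ := μ)]
        refine integral_congr_ae (Filter.Eventually.of_forall fun ω => ?_)
        simp only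
        split_ifs with hz
        · have := sum_prob_mul_bellmanNoise P k γ hγ z
          rw [hz] at this ⊢
          rw [this, mul_zero]
        · simp

end Trajectory

end Moments

/-! ### Recursion for the weighted moments -/

section Recursion

variable {S U : Type*} [Fintype S] [Fintype U] [DecidableEq S] [DecidableEq U]
  [MeasurableSpace S] [MeasurableSingletonClass S] [MeasurableSpace U]
  [MeasurableSingletonClass U]

/-- Recursive inequality for the drift-corrected moments of the Q-learning error. -/
theorem exists_moment_step_bound (P : TransitionKernel S U) (Φ : SamplingPolicy S U)
    (k : S × U → ℝ) (γ : ℝ) (hγ : γ ∈ Set.Ioo (0 : ℝ) 1) (r : ℕ) {α₀ c : ℝ} (hα₀ : 0 ≤ α₀)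
    {f : S × U → S → ℝ} (hf0 : ∀ z i, 0 ≤ f z i)
    (hf : ∀ z i, ∑ j, policyMatrix P Φ i j * f z j
      ≤ f z i + (if i = z.1 then Φ.prob z.1 z.2 else 0) - c) :
    ∃ C : ℝ, 0 ≤ C ∧ ∀ {Ω : Type*} [MeasurableSpace Ω] (μ : Measure Ω) [IsFiniteMeasure μ]
      (X : ℕ → Ω → S) (A : ℕ → Ω → U) (Q₀ : Ω → S × U → ℝ),
      IsSampleTrajectory μ P Φ X A Q₀ → MemLp Q₀ 2 μ → ∀ n : ℕ,
      weightedMoment μ (fun ω => (1 + ‖Q₀ ω‖) ^ 2) r (errorProcess P k γ hγ α₀ X A Q₀ (n + 1))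
        + (2 * r + 2) * (1 - γ) * stepSize α₀ (n + 1)
          * weightedDrift μ (fun ω => (1 + ‖Q₀ ω‖) ^ 2) r
            (errorProcess P k γ hγ α₀ X A Q₀ (n + 1)) f (X (n + 1))
      ≤ (1 + (2 - (2 * r + 2) * (1 - γ) * c) * stepSize α₀ n)
          * weightedMoment μ (fun ω => (1 + ‖Q₀ ω‖) ^ 2) r (errorProcess P k γ hγ α₀ X A Q₀ n)
        + (2 * r + 2) * (1 - γ) * stepSize α₀ n
          * weightedDrift μ (fun ω => (1 + ‖Q₀ ω‖) ^ 2) r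
            (errorProcess P k γ hγ α₀ X A Q₀ n) f (X n)
        + C * stepSize α₀ n ^ (r + 2) * ∫ ω, (1 + ‖Q₀ ω‖) ^ 2 ∂μ := by
  obtain ⟨B, hB, hYB⟩ := exists_norm_scaledError_le P k γ hγ hα₀
  obtain ⟨c₀, hc₀, hν⟩ := exists_abs_bellmanNoise_le P k γ hγ
  obtain ⟨K, hK⟩ := (Set.finite_range fun y : (S × U) × S => f y.1 y.2).bddAbove
  have hfK : ∀ z i, f z i ≤ max K 0 := fun z i =>
    (hK ⟨(z, i), rfl⟩ : f z i ≤ K).trans (le_max_left _ _)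
  obtain ⟨C, hC, hstep⟩ := exists_lyapunov_step_bound (S × U) r hγ hB hc₀ hα₀ (le_max_right K 0)
  refine ⟨C, hC, fun {Ω} _ μ _ X A Q₀ htraj hQ n => ?_⟩
  set b : ℝ := (2 * r + 2) * (1 - γ)
  have hb : 0 ≤ b := mul_nonneg (by positivity) (by linarith [hγ.2])
  set α := stepSize α₀ n with hα_def
  have hα : 0 ≤ α := stepSize_nonneg hα₀ n
  set W : Ω → ℝ := fun ω => (1 + ‖Q₀ ω‖) ^ 2 with hW_def
  have hWi : Integrable W μ := memLp_two_integrable_weight hQ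
  have hW0 : ∀ ω, 0 ≤ W ω := fun ω => sq_nonneg _
  have hev : Even (2 * r + 2) := ⟨r + 1, by ring⟩
  set Y := errorProcess P k γ hγ α₀ X A Q₀ n with hY
  set Y' := errorProcess P k γ hγ α₀ X A Q₀ (n + 1) with hY'
  have hQm : Measurable[historyBeforeAction X A Q₀ n] Q₀ :=
    IsSampleTrajectory.measurable_init_history n
  have hYh : Measurable[historyBeforeAction X A Q₀ n] Y :=
    measurable_scaledError P k γ hγ α₀ hQm n
      (fun m hm => IsSampleTrajectory.measurable_state_history hm)
      (fun m hm => IsSampleTrajectory.measurable_action_history hm)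
  have hWh : Measurable[historyBeforeAction X A Q₀ n] W := measurable_one_add_norm_sq hQm
  have hYzh : ∀ z, Measurable[historyBeforeAction X A Q₀ n] fun ω => Y ω z := fun z =>
    (measurable_pi_apply z).comp hYh
  have hYb : ∀ z, IsBddMeasurable fun ω => Y ω z := fun z =>
    ⟨(hYzh z).mono (htraj.historyBeforeAction_le n) le_rfl, B, fun ω =>
      (norm_le_pi_norm _ z).trans (hYB _ _ _ _)⟩
  have hYb' : ∀ z, IsBddMeasurable fun ω => Y' ω z := fun z =>
    ⟨(measurable_pi_apply z).comp (measurable_scaledError P k γ hγ α₀ htraj.measurable_init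
      (n + 1) (fun m _ => htraj.measurable_state m) (fun m _ => htraj.measurable_action m)),
      B, fun ω => (norm_le_pi_norm _ z).trans (hYB _ _ _ _)⟩
  have hXn : ∀ z m, IsBddMeasurable fun ω => f z (X m ω) := fun z m =>
    .of_finite (htraj.measurable_state m) (f z)
  have hZ : Measurable fun ω => (X n ω, A n ω) :=
    (htraj.measurable_state n).prodMk (htraj.measurable_action n)
  set I : S × U → Ω → ℝ := fun z ω => if z = (X n ω, A n ω) then 1 else 0 with hI
  have hIb : ∀ z, IsBddMeasurable (I z) := fun z =>
    .of_finite hZ fun y : S × U => if z = y then (1 : ℝ) else 0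
  set N : S × U → Ω → ℝ := fun z ω => if z = (X n ω, A n ω) then
    (1 + ‖Q₀ ω‖)⁻¹ * bellmanNoise P k γ hγ z (X (n + 1) ω) else 0 with hN
  have hsm : Measurable[historyBeforeAction X A Q₀ n] fun ω => (1 + ‖Q₀ ω‖)⁻¹ :=
    measurable_one_add_norm_inv hQm
  have hs1 : ∀ ω, |(1 + ‖Q₀ ω‖)⁻¹| ≤ 1 := fun ω => by
    rw [abs_of_pos (by positivity)]
    exact inv_le_one_of_one_le₀ (by linarith [norm_nonneg (Q₀ ω)])
  have hsb : IsBddMeasurable fun ω => (1 + ‖Q₀ ω‖)⁻¹ :=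
    ⟨hsm.mono (htraj.historyBeforeAction_le n) le_rfl, 1, hs1⟩
  have hNb : ∀ z, IsBddMeasurable (N z) := fun z => by
    have h := (hsb.mul (IsBddMeasurable.of_finite (htraj.measurable_state (n + 1))
      (bellmanNoise P k γ hγ z))).mul (hIb z)
    refine ⟨?_, ?_⟩
    · convert h.measurable using 2
      simp only [hN, hI, mul_ite, mul_one, mul_zero]
    · obtain ⟨D, hD⟩ := h.bdd
      refine ⟨D, fun ω => ?_⟩
      convert hD ω using 2
      simp only [hN, hI, mul_ite, mul_one, mul_zero]
  -- On the right, f is already taken at X_{n+1} but the error is still the old one. Its coefficient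
  -- is thus known before the action, as the drift inequality in expectation requires.
  have hpath : ∀ ω, W ω * ∑ z, Y' ω z ^ (2 * r + 2)
        + b * α * (W ω * ∑ z, Y' ω z ^ (2 * r + 2) * f z (X (n + 1) ω))
      ≤ (1 + 2 * α) * (W ω * ∑ z, Y ω z ^ (2 * r + 2))
        - b * α * (W ω * ∑ z, Y ω z ^ (2 * r + 2) * I z ω)
        + (2 * r + 2) * α * (W ω * ∑ z, Y ω z ^ (2 * r + 1) * N z ω)
        + b * α * (W ω * ∑ z, Y ω z ^ (2 * r + 2) * f z (X (n + 1) ω))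
        + C * α ^ (r + 2) * W ω := by
    intro ω
    obtain ⟨g, hg, hrec⟩ := scaledError_succ P k γ hγ α₀ (fun m => X m ω) (fun m => A m ω)
      (Q₀ ω) n
    have h := hstep (Y ω) (Y' ω)
      (fun z => (1 + ‖Q₀ ω‖)⁻¹ * bellmanNoise P k γ hγ z (X (n + 1) ω))
      (fun z => f z (X (n + 1) ω)) g α (X n ω, A n ω) (hYB _ _ _ _) hg
      (fun z => by
        rw [abs_mul]
        exact (mul_le_of_le_one_left (abs_nonneg _) (hs1 ω)).trans (hν _ _))
      (fun z => hf0 _ _) (fun z => hfK _ _) hα (stepSize_le hα₀ n) hrec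
    have h' := mul_le_mul_of_nonneg_left h (hW0 ω)
    linarith
  have i1 := (IsBddMeasurable.sum Finset.univ fun z => (hYb' z).pow (2 * r + 2)).integrable_mul hWi
  have i2 := (IsBddMeasurable.sum Finset.univ fun z =>
    ((hYb' z).pow (2 * r + 2)).mul (hXn z (n + 1))).integrable_mul hWi
  have i3 := (IsBddMeasurable.sum Finset.univ fun z => (hYb z).pow (2 * r + 2)).integrable_mul hWi
  have i4 := (IsBddMeasurable.sum Finset.univ fun z =>
    ((hYb z).pow (2 * r + 2)).mul (hIb z)).integrable_mul hWi
  have i5 := (IsBddMeasurable.sum Finset.univ fun z =>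
    ((hYb z).pow (2 * r + 1)).mul (hNb z)).integrable_mul hWi
  have i6 := (IsBddMeasurable.sum Finset.univ fun z =>
    ((hYb z).pow (2 * r + 2)).mul (hXn z (n + 1))).integrable_mul hWi
  have hint := integral_mono (i1.add (i2.const_mul (b * α)))
    (((((i3.const_mul (1 + 2 * α)).sub (i4.const_mul (b * α))).add
      (i5.const_mul ((2 * r + 2) * α))).add (i6.const_mul (b * α))).add
        (hWi.const_mul (C * α ^ (r + 2)))) hpath
  rw [integral_add' i1 (i2.const_mul _), integral_add' (((((i3.const_mul _).sub (i4.const_mul _)).add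
    (i5.const_mul _)).add (i6.const_mul _))) (hWi.const_mul _),
    integral_add' ((((i3.const_mul _).sub (i4.const_mul _)).add
    (i5.const_mul _))) (i6.const_mul _),
    integral_add' ((i3.const_mul _).sub (i4.const_mul _)) (i5.const_mul _),
    integral_sub' (i3.const_mul _) (i4.const_mul _)] at hint
  simp only [integral_const_mul] at hint
  have hsum : ∀ h : S × U → Ω → ℝ, (∀ z, IsBddMeasurable (h z)) →
      ∫ ω, W ω * ∑ z, h z ω ∂μ = ∑ z, ∫ ω, W ω * h z ω ∂μ := by
    intro h hh
    simp only [Finset.mul_sum]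
    exact integral_finsetSum _ fun z _ => (hh z).integrable_mul hWi
  -- The random scaling of the noise is a function of Q₀, so it is moved into the factor known
  -- before the action.
  have hnoise : ∫ ω, W ω * ∑ z, Y ω z ^ (2 * r + 1) * N z ω ∂μ = 0 := by
    rw [hsum _ fun z => ((hYb z).pow (2 * r + 1)).mul (hNb z)]
    refine Finset.sum_eq_zero fun z _ => ?_
    have h := htraj.integral_mul_noise_eq_zero n k γ hγ z
      (F := fun ω => W ω * (Y ω z ^ (2 * r + 1) * (1 + ‖Q₀ ω‖)⁻¹))
      (hWh.mul (((hYzh z).pow_const _).mul hsm))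
      ((((hYb z).pow _).mul hsb).integrable_mul hWi)
    rw [← h]
    refine integral_congr_ae (Filter.Eventually.of_forall fun ω => ?_)
    simp only [hN]
    split_ifs <;> ring
  -- The visit integral on the right cancels the one with opposite sign in `hint`, leaving -c times
  -- the full moment.
  have hdrift : ∫ ω, W ω * ∑ z, Y ω z ^ (2 * r + 2) * f z (X (n + 1) ω) ∂μ
      ≤ weightedDrift μ W r Y f (X n) + ∫ ω, W ω * ∑ z, Y ω z ^ (2 * r + 2) * I z ω ∂μ
        - c * weightedMoment μ W r Y := by
    unfold weightedDrift weightedMoment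
    rw [hsum _ fun z => ((hYb z).pow (2 * r + 2)).mul (hXn z (n + 1)),
      hsum _ fun z => ((hYb z).pow (2 * r + 2)).mul (hXn z n),
      hsum _ fun z => ((hYb z).pow (2 * r + 2)).mul (hIb z),
      hsum _ fun z => (hYb z).pow (2 * r + 2), Finset.mul_sum, ← Finset.sum_add_distrib,
      ← Finset.sum_sub_distrib]
    refine Finset.sum_le_sum fun z _ => ?_
    have h := htraj.integral_mul_drift_le n (hf z) (F := fun ω => W ω * Y ω z ^ (2 * r + 2))
      (hWh.mul ((hYzh z).pow_const _)) (((hYb z).pow _).integrable_mul hWi)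
      (fun ω => mul_nonneg (hW0 ω) (hev.pow_nonneg _))
    simpa only [mul_assoc] using h
  have hH0 : 0 ≤ weightedDrift μ W r Y' f (X (n + 1)) :=
    integral_nonneg fun ω => mul_nonneg (hW0 ω) (Finset.sum_nonneg fun z _ =>
      mul_nonneg (hev.pow_nonneg _) (hf0 _ _))
  have hanti : stepSize α₀ (n + 1) ≤ α := by
    rw [hα_def]
    unfold stepSize
    push_cast
    gcongr
    linarith
  have hlhs : b * stepSize α₀ (n + 1) * weightedDrift μ W r Y' f (X (n + 1))
      ≤ b * α * weightedDrift μ W r Y' f (X (n + 1)) := by gcongr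
  have hd := mul_le_mul_of_nonneg_left hdrift (mul_nonneg hb hα)
  rw [hnoise] at hint
  change weightedMoment μ W r Y' + b * α * weightedDrift μ W r Y' f (X (n + 1))
    ≤ (1 + 2 * α) * weightedMoment μ W r Y - _ + _ + _ + _ at hint
  linarith

end Recursion

/-! ### Deterministic recursions -/

section RealRecursion

/-- Chung's lemma: a recursion with contraction `a / (n + 1)` and perturbation of order
`(n + 1) ^ (-(q + 1))` decays like `(n + 1) ^ (-q)` if `a ≥ q + 1`. -/
theorem le_div_pow_of_recursion {v : ℕ → ℝ} {q N : ℕ} {a D V₀ : ℝ} (hD : 0 ≤ D) (hV₀ : 0 ≤ V₀)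
    (ha : (q : ℝ) + 1 ≤ a) (haN : a ≤ N + 1) (hN : v N ≤ V₀)
    (hv : ∀ n, N ≤ n → v (n + 1) ≤ (1 - a / (n + 1)) * v n + D / ((n : ℝ) + 1) ^ (q + 1))
    (n : ℕ) (hn : N ≤ n) : v n ≤ (V₀ * ((N : ℝ) + 1) ^ q + D) / ((n : ℝ) + 1) ^ q := by
  induction n, hn using Nat.le_induction with
  | base =>
    rw [le_div_iff₀ (by positivity)]
    have : v N * ((N : ℝ) + 1) ^ q ≤ V₀ * ((N : ℝ) + 1) ^ q := by gcongr
    linarith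
  | succ n hn ih =>
    set C := V₀ * ((N : ℝ) + 1) ^ q + D
    have hC : D ≤ C := le_add_of_nonneg_left (by positivity)
    have hm : (0 : ℝ) < (n : ℝ) + 1 := by positivity
    have ham : a / ((n : ℝ) + 1) ≤ 1 := by
      rw [div_le_one hm]
      have : (N : ℝ) ≤ n := by exact_mod_cast hn
      linarith
    have h1 := mul_le_mul_of_nonneg_left ih (sub_nonneg.2 ham)
    -- Bernoulli: passing from (n+1)^(-q) to (n+2)^(-q) costs at most q/(n+1), less than the
    -- contraction a/(n+1).
    have hbern : 1 - q / ((n : ℝ) + 1) ≤ (((n : ℝ) + 1) / ((n : ℝ) + 2)) ^ q := by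
      have h := one_add_mul_le_pow (a := -(1 / ((n : ℝ) + 2)))
        (by
          have : 1 / ((n : ℝ) + 2) ≤ 1 := by
            rw [div_le_one (by positivity)]; linarith [n.cast_nonneg (α := ℝ)]
          linarith) q
      have e : 1 + -(1 / ((n : ℝ) + 2)) = ((n : ℝ) + 1) / ((n : ℝ) + 2) := by
        field_simp; ring
      rw [e] at h
      refine le_trans ?_ h
      have : (q : ℝ) / ((n : ℝ) + 2) ≤ q / ((n : ℝ) + 1) := by gcongr; norm_num
      have e2 : (q : ℝ) * -(1 / ((n : ℝ) + 2)) = -(q / ((n : ℝ) + 2)) := by ring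
      rw [e2]
      linarith
    push_cast
    rw [show (n : ℝ) + 1 + 1 = n + 2 by ring]
    have e1 : C / ((n : ℝ) + 2) ^ q
        = C / ((n : ℝ) + 1) ^ q * (((n : ℝ) + 1) / ((n : ℝ) + 2)) ^ q := by
      rw [div_pow]; field_simp
    have hCq : 0 ≤ C / ((n : ℝ) + 1) ^ q := div_nonneg (hD.trans hC) (by positivity)
    have h2 := mul_le_mul_of_nonneg_left hbern hCq
    have e3 : (1 - a / ((n : ℝ) + 1)) * (C / ((n : ℝ) + 1) ^ q) + D / ((n : ℝ) + 1) ^ (q + 1)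
        = C / ((n : ℝ) + 1) ^ q * (1 - q / ((n : ℝ) + 1))
          - ((a - q) * C - D) / ((n : ℝ) + 1) ^ (q + 1) := by
      field_simp; ring
    have h3 : 0 ≤ ((a - q) * C - D) / ((n : ℝ) + 1) ^ (q + 1) := by
      refine div_nonneg ?_ (by positivity)
      nlinarith [hD.trans hC]
    rw [e1]
    linarith [hv n hn]

theorem div_pow_le_div_pow_of_le {C : ℝ} (hC : 0 ≤ C) (q : ℕ) {n N : ℕ} (h : n ≤ N) :
    C ≤ C * ((N : ℝ) + 1) ^ q / ((n : ℝ) + 1) ^ q := by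
  rw [le_div_iff₀ (by positivity)]
  have : (n : ℝ) ≤ N := by exact_mod_cast h
  gcongr

/-- While the step exceeds 1 the update is not convex, and only the crude growth bound is used, for
finitely many steps. Then Chung's lemma with q = 1 applies, whence β₀ ≥ 2. The constant is chosen
before the sequence, for uniformity. -/
theorem exists_average_recursion_bound {β₀ K R : ℝ} (hβ₀ : 2 ≤ β₀) (hK : 0 ≤ K) (hR : 0 ≤ R) :
    ∃ C : ℝ, ∀ e : ℕ → ℝ, e 0 ≤ R →
      (∀ n, e (n + 1) ≤ 2 * (1 + β₀) ^ 2 * (e n + K)) →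
      (∀ n, stepSize β₀ n ≤ 1 →
        e (n + 1) ≤ (1 - stepSize β₀ n) * e n + stepSize β₀ n * (K / ((n : ℝ) + 1))) →
      ∀ n : ℕ, e n ≤ C / ((n : ℝ) + 1) := by
  have hβ : 0 ≤ β₀ := by linarith
  have hearly : ∀ N : ℕ, ∃ G : ℝ, 0 ≤ G ∧ ∀ e : ℕ → ℝ, e 0 ≤ R →
      (∀ n, e (n + 1) ≤ 2 * (1 + β₀) ^ 2 * (e n + K)) → ∀ n ≤ N, e n ≤ G := by
    intro N
    induction N with
    | zero => exact ⟨R, hR, fun e h0 _ n hn => by rwa [Nat.le_zero.1 hn]⟩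
    | succ N ih =>
      obtain ⟨G, hG, h⟩ := ih
      refine ⟨max G (2 * (1 + β₀) ^ 2 * (G + K)), le_max_of_le_left hG, fun e h0 he n hn => ?_⟩
      rcases Nat.le_succ_iff.1 hn with hn | rfl
      · exact (h e h0 he n hn).trans (le_max_left _ _)
      · refine (he N).trans (le_trans ?_ (le_max_right _ _))
        have := h e h0 he N le_rfl
        gcongr
  obtain ⟨N, hN⟩ := exists_nat_ge (β₀ / 1)
  obtain ⟨G, hG, h⟩ := hearly N
  refine ⟨G * ((N : ℝ) + 1) ^ 1 + β₀ * K, fun e h0 he1 he2 n => ?_⟩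
  rcases le_total n N with hn | hn
  · refine (h e h0 he1 n hn).trans ((div_pow_le_div_pow_of_le hG 1 hn).trans ?_)
    rw [pow_one ((n : ℝ) + 1)]
    gcongr
    exact le_add_of_nonneg_right (by positivity)
  · rw [div_one] at hN
    have := le_div_pow_of_recursion (v := e) (q := 1) (a := β₀) (D := β₀ * K)
      (by positivity) hG (by push_cast; linarith) (by linarith) (h e h0 he1 N le_rfl)
      (fun m hm => by
        have hs : stepSize β₀ m ≤ 1 := stepSize_le_of_le one_pos
          ((div_one β₀).trans_le (hN.trans (by exact_mod_cast hm)))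
        refine (he2 m hs).trans (le_of_eq ?_)
        unfold stepSize
        field_simp
        ring) n hn
    rwa [pow_one ((n : ℝ) + 1)] at this

end RealRecursion

/-! ### Averaging preserves the mean-square rate -/

section Averaging

theorem norm_sq_step_le {E : Type*} [NormedAddCommGroup E] [NormedSpace ℝ E] (a d : E) {β β₀ : ℝ}
    (hβ : 0 ≤ β) (hβ₀ : β ≤ β₀) :
    ‖d + β • (a - d)‖ ^ 2 ≤ 2 * (1 + β₀) ^ 2 * (‖d‖ ^ 2 + ‖a‖ ^ 2) := by
  have h1 : ‖d + β • (a - d)‖ ≤ (1 + β₀) * (‖d‖ + ‖a‖) := by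
    calc ‖d + β • (a - d)‖ ≤ ‖d‖ + β * (‖a‖ + ‖d‖) := by
          refine (norm_add_le _ _).trans (add_le_add_right ?_ _)
          rw [norm_smul, Real.norm_eq_abs, abs_of_nonneg hβ]
          exact mul_le_mul_of_nonneg_left (norm_sub_le _ _) hβ
      _ ≤ ‖d‖ + β₀ * (‖a‖ + ‖d‖) := by gcongr
      _ ≤ _ := by nlinarith [norm_nonneg a, norm_nonneg d]
  have h2 : (‖d‖ + ‖a‖) ^ 2 ≤ 2 * (‖d‖ ^ 2 + ‖a‖ ^ 2) := by nlinarith [sq_nonneg (‖d‖ - ‖a‖)]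
  calc ‖d + β • (a - d)‖ ^ 2 ≤ ((1 + β₀) * (‖d‖ + ‖a‖)) ^ 2 := by gcongr
    _ = (1 + β₀) ^ 2 * (‖d‖ + ‖a‖) ^ 2 := by ring
    _ ≤ (1 + β₀) ^ 2 * (2 * (‖d‖ ^ 2 + ‖a‖ ^ 2)) := by gcongr
    _ = _ := by ring

theorem norm_sq_convex_step_le {E : Type*} [NormedAddCommGroup E] [NormedSpace ℝ E] (a d : E)
    {β : ℝ} (hβ : 0 ≤ β) (hβ1 : β ≤ 1) :
    ‖d + β • (a - d)‖ ^ 2 ≤ (1 - β) * ‖d‖ ^ 2 + β * ‖a‖ ^ 2 := by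
  have h1 : ‖d + β • (a - d)‖ ≤ (1 - β) * ‖d‖ + β * ‖a‖ := by
    rw [show d + β • (a - d) = (1 - β) • d + β • a by module]
    refine (norm_add_le _ _).trans (le_of_eq ?_)
    rw [norm_smul, norm_smul, Real.norm_eq_abs, Real.norm_eq_abs, abs_of_nonneg hβ,
      abs_of_nonneg (by linarith)]
  calc ‖d + β • (a - d)‖ ^ 2 ≤ ((1 - β) * ‖d‖ + β * ‖a‖) ^ 2 := by gcongr
    _ ≤ _ := by nlinarith [mul_nonneg (mul_nonneg hβ (sub_nonneg.2 hβ1)) (sq_nonneg (‖d‖ - ‖a‖))]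

/-- Averaging with step sizes `β₀ / (n + 1)` preserves the mean-square rate `1 / (n + 1)`. -/
theorem exists_average_bound {β₀ K R : ℝ} (hβ₀ : 2 ≤ β₀) (hK : 0 ≤ K) (hR : 0 ≤ R) :
    ∃ C : ℝ, ∀ {Ω E : Type*} [MeasurableSpace Ω] [NormedAddCommGroup E] [NormedSpace ℝ E]
      (μ : Measure Ω) (a d : ℕ → Ω → E), (∀ n, MemLp (a n) 2 μ) → MemLp (d 0) 2 μ →
      (∀ n ω, d (n + 1) ω = d n ω + stepSize β₀ n • (a n ω - d n ω)) →
      (∀ n : ℕ, ∫ ω, ‖a n ω‖ ^ 2 ∂μ ≤ K / ((n : ℝ) + 1)) → ∫ ω, ‖d 0 ω‖ ^ 2 ∂μ ≤ R →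
      ∀ n : ℕ, Integrable (fun ω => ‖d n ω‖ ^ 2) μ ∧ ∫ ω, ‖d n ω‖ ^ 2 ∂μ ≤ C / ((n : ℝ) + 1) := by
  obtain ⟨C, hC⟩ := exists_average_recursion_bound hβ₀ hK hR
  refine ⟨C, fun {Ω E} _ _ _ μ a d ha hd0 hd haK hdR n => ?_⟩
  have hβ : 0 ≤ β₀ := by linarith
  have hdL : ∀ n, MemLp (d n) 2 μ := by
    intro n
    induction n with
    | zero => exact hd0
    | succ n ih =>
      rw [show d (n + 1) = d n + stepSize β₀ n • (a n - d n) from funext (hd n)]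
      exact ih.add (((ha n).sub ih).const_smul _)
  have hdi : ∀ n, Integrable (fun ω => ‖d n ω‖ ^ 2) μ := fun n =>
    (hdL n).integrable_norm_pow two_ne_zero
  have hai : ∀ n, Integrable (fun ω => ‖a n ω‖ ^ 2) μ := fun n =>
    (ha n).integrable_norm_pow two_ne_zero
  refine ⟨hdi n, hC (fun n => ∫ ω, ‖d n ω‖ ^ 2 ∂μ) hdR (fun n => ?_) (fun n hn => ?_) n⟩
  · have h1 : ∫ ω, ‖d (n + 1) ω‖ ^ 2 ∂μ
        ≤ ∫ ω, 2 * (1 + β₀) ^ 2 * (‖d n ω‖ ^ 2 + ‖a n ω‖ ^ 2) ∂μ :=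
      integral_mono (hdi _) (((hdi n).add (hai n)).const_mul _) fun ω => by
        simp only [hd n ω]
        exact norm_sq_step_le _ _ (stepSize_nonneg hβ n) (stepSize_le hβ n)
    rw [integral_const_mul, integral_add (hdi n) (hai n)] at h1
    have h2 : ∫ ω, ‖a n ω‖ ^ 2 ∂μ ≤ K :=
      (haK n).trans (div_le_self hK (by linarith [n.cast_nonneg (α := ℝ)]))
    exact h1.trans (by gcongr)
  · have h1 : ∫ ω, ‖d (n + 1) ω‖ ^ 2 ∂μ
        ≤ ∫ ω, ((1 - stepSize β₀ n) * ‖d n ω‖ ^ 2 + stepSize β₀ n * ‖a n ω‖ ^ 2) ∂μ :=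
      integral_mono (hdi _) (((hdi n).const_mul _).add ((hai n).const_mul _)) fun ω => by
        simp only [hd n ω]
        exact norm_sq_convex_step_le _ _ (stepSize_nonneg hβ n) hn
    rw [integral_add ((hdi n).const_mul _) ((hai n).const_mul _), integral_const_mul,
      integral_const_mul] at h1
    have h2 := mul_le_mul_of_nonneg_left (haK n) (stepSize_nonneg hβ n)
    exact h1.trans (by linarith)

end Averaging

/-! ### Rates for Q-learning with large steps -/

section Rate

variable {S U : Type*} [Fintype S] [Fintype U] [DecidableEq S] [DecidableEq U]
  [MeasurableSpace S] [MeasurableSingletonClass S] [MeasurableSpace U]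
  [MeasurableSingletonClass U]

/-- Chung's lemma with q = r + 1 and contraction α₀/(n+1), which explains r + 2 ≤ α₀. It is applied
to the corrected moment V, comparable to the moment itself once steps are small. -/
theorem exists_weightedMoment_le (P : TransitionKernel S U) (Φ : SamplingPolicy S U)
    (k : S × U → ℝ) (γ : ℝ) (hγ : γ ∈ Set.Ioo (0 : ℝ) 1) (r : ℕ) {α₀ c : ℝ}
    (hα₀ : (r : ℝ) + 2 ≤ α₀) (hc : 4 ≤ (2 * r + 2) * (1 - γ) * c)
    {f : S × U → S → ℝ} (hf0 : ∀ z i, 0 ≤ f z i)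
    (hf : ∀ z i, ∑ j, policyMatrix P Φ i j * f z j
      ≤ f z i + (if i = z.1 then Φ.prob z.1 z.2 else 0) - c) :
    ∃ C : ℝ, 0 ≤ C ∧ ∀ {Ω : Type*} [MeasurableSpace Ω] (μ : Measure Ω) [IsFiniteMeasure μ]
      (X : ℕ → Ω → S) (A : ℕ → Ω → U) (Q₀ : Ω → S × U → ℝ),
      IsSampleTrajectory μ P Φ X A Q₀ → MemLp Q₀ 2 μ → ∀ n : ℕ,
      weightedMoment μ (fun ω => (1 + ‖Q₀ ω‖) ^ 2) r (errorProcess P k γ hγ α₀ X A Q₀ n)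
        ≤ C * (∫ ω, (1 + ‖Q₀ ω‖) ^ 2 ∂μ) / ((n : ℝ) + 1) ^ (r + 1) := by
  have hα₀' : 0 ≤ α₀ := by linarith [r.cast_nonneg (α := ℝ)]
  obtain ⟨B, hB, hYB⟩ := exists_norm_scaledError_le P k γ hγ hα₀'
  obtain ⟨C, hC, hstep⟩ := exists_moment_step_bound P Φ k γ hγ r hα₀' hf0 hf
  obtain ⟨K, hK⟩ := (Set.finite_range fun y : (S × U) × S => f y.1 y.2).bddAbove
  have hfK : ∀ z i, f z i ≤ max K 0 := fun z i =>
    (hK ⟨(z, i), rfl⟩ : f z i ≤ K).trans (le_max_left _ _)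
  have hK0 : 0 ≤ max K 0 := le_max_right _ _
  generalize max K 0 = K' at hfK hK0
  set b : ℝ := (2 * r + 2) * (1 - γ)
  have hb : 0 ≤ b := mul_nonneg (by positivity) (by linarith [hγ.2])
  have hbK : 0 < b * K' + 1 := by positivity
  -- Beyond N the correction is at most the moment itself, and the contraction factor 1 - α₀/(n+1)
  -- is nonnegative.
  obtain ⟨N, hN⟩ := exists_nat_ge (max (α₀ / (1 / (b * K' + 1))) α₀)
  have hev : Even (2 * r + 2) := ⟨r + 1, by ring⟩
  set G : ℝ := Fintype.card (S × U) * B ^ (2 * r + 2)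
  have hG : 0 ≤ G := by positivity
  refine ⟨2 * G * ((N : ℝ) + 1) ^ (r + 1) + C * α₀ ^ (r + 2), by positivity,
    fun {Ω} _ μ _ X A Q₀ htraj hQ n => ?_⟩
  set W : Ω → ℝ := fun ω => (1 + ‖Q₀ ω‖) ^ 2 with hW_def
  have hWi : Integrable W μ := memLp_two_integrable_weight hQ
  have hW0 : ∀ ω, 0 ≤ W ω := fun ω => sq_nonneg _
  set w := ∫ ω, W ω ∂μ
  have hw : 0 ≤ w := integral_nonneg hW0
  set Y := errorProcess P k γ hγ α₀ X A Q₀ with hY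
  have hYb : ∀ m z, IsBddMeasurable fun ω => Y m ω z := fun m z =>
    ⟨(measurable_pi_apply z).comp (measurable_scaledError P k γ hγ α₀ htraj.measurable_init
      m (fun i _ => htraj.measurable_state i) (fun i _ => htraj.measurable_action i)),
      B, fun ω => (norm_le_pi_norm _ z).trans (hYB _ _ _ _)⟩
  have hXm : ∀ z m, IsBddMeasurable fun ω => f z (X m ω) := fun z m =>
    .of_finite (htraj.measurable_state m) (f z)
  have hAi : ∀ m, Integrable (fun ω => W ω * ∑ z, Y m ω z ^ (2 * r + 2)) μ := fun m =>
    (IsBddMeasurable.sum Finset.univ fun z => (hYb m z).pow (2 * r + 2)).integrable_mul hWi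
  have hHi : ∀ m, Integrable (fun ω => W ω * ∑ z, Y m ω z ^ (2 * r + 2) * f z (X m ω)) μ :=
    fun m => (IsBddMeasurable.sum Finset.univ fun z =>
      ((hYb m z).pow (2 * r + 2)).mul (hXm z m)).integrable_mul hWi
  have hAG : ∀ m, weightedMoment μ W r (Y m) ≤ G * w := by
    intro m
    rw [← integral_const_mul]
    refine integral_mono (hAi m) (hWi.const_mul G) fun ω => ?_
    have : ∑ z, Y m ω z ^ (2 * r + 2) ≤ G := by
      refine (Finset.sum_le_card_nsmul Finset.univ _ (B ^ (2 * r + 2)) fun z _ => ?_).trans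
        (le_of_eq (by rw [Finset.card_univ, nsmul_eq_mul]))
      rw [← hev.pow_abs]
      exact pow_le_pow_left₀ (abs_nonneg _) ((norm_le_pi_norm _ z).trans (hYB _ _ _ _)) _
    simp only
    rw [mul_comm]
    exact mul_le_mul_of_nonneg_right this (hW0 ω)
  have hHK : ∀ m, weightedDrift μ W r (Y m) f (X m) ≤ K' * weightedMoment μ W r (Y m) := by
    intro m
    unfold weightedDrift weightedMoment
    rw [← integral_const_mul]
    refine integral_mono (hHi m) ((hAi m).const_mul K') fun ω => ?_
    simp only
    rw [mul_left_comm, Finset.mul_sum Finset.univ _ K']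
    refine mul_le_mul_of_nonneg_left (Finset.sum_le_sum fun z _ => ?_) (hW0 ω)
    rw [mul_comm]
    exact mul_le_mul_of_nonneg_right (hfK _ _) (hev.pow_nonneg _)
  have hH0 : ∀ m, 0 ≤ weightedDrift μ W r (Y m) f (X m) := fun m =>
    integral_nonneg fun ω => mul_nonneg (hW0 ω) (Finset.sum_nonneg fun z _ =>
      mul_nonneg (hev.pow_nonneg _) (hf0 _ _))
  have hA0 : ∀ m, 0 ≤ weightedMoment μ W r (Y m) := fun m =>
    integral_nonneg fun ω => mul_nonneg (hW0 ω) (Finset.sum_nonneg fun z _ => hev.pow_nonneg _)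
  have hC' : 0 ≤ C * α₀ ^ (r + 2) := by positivity
  rcases le_total n N with hn | hn
  · refine (hAG n).trans ((div_pow_le_div_pow_of_le (by positivity) (r + 1) hn).trans ?_)
    refine div_le_div_of_nonneg_right ?_ (by positivity)
    have h1 : 0 ≤ G * ((N : ℝ) + 1) ^ (r + 1) * w := by positivity
    have h2 : 0 ≤ C * α₀ ^ (r + 2) * w := by positivity
    linarith
  set V : ℕ → ℝ := fun m => weightedMoment μ W r (Y m)
    + b * stepSize α₀ m * weightedDrift μ W r (Y m) f (X m) with hV
  have hVA : ∀ m, N ≤ m → V m ≤ 2 * weightedMoment μ W r (Y m) := by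
    intro m hm
    have hs : stepSize α₀ m ≤ 1 / (b * K' + 1) := stepSize_le_of_le (by positivity)
      ((le_max_left _ _).trans (hN.trans (by exact_mod_cast hm)))
    have hs0 : 0 ≤ stepSize α₀ m := stepSize_nonneg hα₀' m
    rw [le_div_iff₀ hbK] at hs
    have h1 : b * stepSize α₀ m * weightedDrift μ W r (Y m) f (X m)
        ≤ b * stepSize α₀ m * (K' * weightedMoment μ W r (Y m)) :=
      mul_le_mul_of_nonneg_left (hHK m) (by positivity)
    have h2 : b * stepSize α₀ m * K' ≤ 1 := by linarith
    have h3 := mul_le_mul_of_nonneg_right h2 (hA0 m)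
    simp only [hV]
    linarith
  have hrec : ∀ m, N ≤ m → V (m + 1) ≤ (1 - α₀ / (m + 1)) * V m
      + C * α₀ ^ (r + 2) * w / ((m : ℝ) + 1) ^ (r + 1 + 1) := by
    intro m hm
    have h1 := hstep μ X A Q₀ htraj hQ m
    have hs0 : 0 ≤ stepSize α₀ m := stepSize_nonneg hα₀' m
    -- bc ≥ 4 leaves a drift of at most -2α times the moment, which is at most -αV since V is at
    -- most twice the moment.
    have h2 : (2 - b * c) * stepSize α₀ m * weightedMoment μ W r (Y m)
        ≤ -stepSize α₀ m * V m := by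
      have e1 := mul_le_mul_of_nonneg_left (hVA m hm) hs0
      have e2 : 0 ≤ (b * c - 4) * (stepSize α₀ m * weightedMoment μ W r (Y m)) :=
        mul_nonneg (by linarith) (mul_nonneg hs0 (hA0 m))
      linarith
    have h3 : C * stepSize α₀ m ^ (r + 2) * w
        = C * α₀ ^ (r + 2) * w / ((m : ℝ) + 1) ^ (r + 1 + 1) := by
      unfold stepSize
      rw [div_pow]
      ring
    rw [← h3]
    change V (m + 1) ≤ _ at h1
    change _ ≤ (1 - stepSize α₀ m) * V m + _
    have h4 : V m = weightedMoment μ W r (Y m)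
      + b * stepSize α₀ m * weightedDrift μ W r (Y m) f (X m) := rfl
    linarith
  have hfin := le_div_pow_of_recursion (v := V) (q := r + 1) (a := α₀) (V₀ := 2 * (G * w))
    (D := C * α₀ ^ (r + 2) * w) (by positivity) (by positivity) (by push_cast; linarith)
    (by linarith [(le_max_right _ _).trans hN])
    ((hVA N le_rfl).trans (by linarith [hAG N])) hrec n hn
  have hAV : weightedMoment μ W r (Y n) ≤ V n :=
    le_add_of_nonneg_right (mul_nonneg (mul_nonneg hb (stepSize_nonneg hα₀' n)) (hH0 n))
  refine hAV.trans (hfin.trans (le_of_eq ?_))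
  ring

/-- Mean-square rate `1 / (n + 1)` of asynchronous Q-learning with large steps. -/
theorem exists_qLearning_rate (P : TransitionKernel S U) (Φ : SamplingPolicy S U)
    (hirr : (policyMatrix P Φ).IsIrreducible) (γ : ℝ) (hγ : γ ∈ Set.Ioo (0 : ℝ) 1) :
    ∃ a : ℝ, 0 < a ∧ ∀ (k : S × U → ℝ) (α₀ : ℝ), a ≤ α₀ → ∃ C : ℝ, 0 ≤ C ∧
      ∀ {Ω : Type*} [MeasurableSpace Ω] (μ : Measure Ω) [IsFiniteMeasure μ]
        (X : ℕ → Ω → S) (A : ℕ → Ω → U) (Q₀ : Ω → S × U → ℝ),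
        IsSampleTrajectory μ P Φ X A Q₀ → MemLp Q₀ 2 μ → ∀ n : ℕ,
        MemLp (fun ω => qLearning k γ α₀ (fun m => X m ω) (fun m => A m ω) (Q₀ ω) n
          - optimalQ P k γ hγ) 2 μ ∧
        ∫ ω, ‖qLearning k γ α₀ (fun m => X m ω) (fun m => A m ω) (Q₀ ω) n
          - optimalQ P k γ hγ‖ ^ 2 ∂μ ≤ C * (∫ ω, (1 + ‖Q₀ ω‖) ^ 2 ∂μ) / ((n : ℝ) + 1) := by
  obtain ⟨c, hc, f, hf0, hf⟩ := exists_visit_drift P Φ hirr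
  have hγ1 : 0 < 1 - γ := by linarith [hγ.2]
  -- The exponent is fixed by γ and the visit frequency alone, so the threshold r + 2 for α₀ does
  -- not depend on the cost.
  obtain ⟨r, hr⟩ := exists_nat_ge (4 / ((1 - γ) * c))
  have hrc : 4 ≤ (2 * r + 2) * (1 - γ) * c := by
    rw [div_le_iff₀ (by positivity)] at hr
    have : 0 ≤ ((r : ℝ) + 2) * ((1 - γ) * c) := by positivity
    linarith
  refine ⟨r + 2, by positivity, fun k α₀ hα₀ => ?_⟩
  have hα₀' : 0 ≤ α₀ := by linarith [r.cast_nonneg (α := ℝ)]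
  obtain ⟨C, hC, H⟩ := exists_weightedMoment_le P Φ k γ hγ r hα₀ hrc hf0 hf
  obtain ⟨B, hB, hYB⟩ := exists_norm_scaledError_le P k γ hγ hα₀'
  refine ⟨1 + C, by positivity, fun {Ω} _ μ _ X A Q₀ htraj hQ n => ?_⟩
  set W : Ω → ℝ := fun ω => (1 + ‖Q₀ ω‖) ^ 2 with hW_def
  have hWi : Integrable W μ := memLp_two_integrable_weight hQ
  have hW0 : ∀ ω, 0 ≤ W ω := fun ω => sq_nonneg _
  set Y := errorProcess P k γ hγ α₀ X A Q₀ n with hY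
  have hYm : Measurable Y := measurable_scaledError P k γ hγ α₀ htraj.measurable_init
    n (fun i _ => htraj.measurable_state i) (fun i _ => htraj.measurable_action i)
  have hYb : ∀ z, IsBddMeasurable fun ω => Y ω z := fun z =>
    ⟨(measurable_pi_apply z).comp hYm, B, fun ω => (norm_le_pi_norm _ z).trans (hYB _ _ _ _)⟩
  have hnormb : IsBddMeasurable fun ω => ‖Y ω‖ := ⟨hYm.norm, B, fun ω => by
    rw [abs_norm]; exact hYB _ _ _ _⟩
  have hsq : ∀ ω, ‖qLearning k γ α₀ (fun m => X m ω) (fun m => A m ω) (Q₀ ω) n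
      - optimalQ P k γ hγ‖ ^ 2 = W ω * ‖Y ω‖ ^ 2 := by
    intro ω
    have hs : (0 : ℝ) < 1 + ‖Q₀ ω‖ := by positivity
    simp only [hY, errorProcess, scaledError, hW_def]
    rw [norm_smul, Real.norm_eq_abs, abs_of_pos (by positivity), ← mul_pow,
      mul_inv_cancel_left₀ hs.ne']
  have hi : Integrable (fun ω => W ω * ‖Y ω‖ ^ 2) μ := (hnormb.pow 2).integrable_mul hWi
  have hQm : Measurable fun ω => qLearning k γ α₀ (fun m => X m ω) (fun m => A m ω) (Q₀ ω) n
      - optimalQ P k γ hγ :=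
    (measurable_qLearning k γ α₀ htraj.measurable_init n (fun i _ => htraj.measurable_state i)
      (fun i _ => htraj.measurable_action i)).sub_const _
  constructor
  · rw [memLp_two_iff_integrable_sq_norm hQm.aestronglyMeasurable]
    exact hi.congr (Filter.Eventually.of_forall fun ω => (hsq ω).symm)
  · simp only [hsq]
    have hn : (0 : ℝ) < (n : ℝ) + 1 := by positivity
    have hAi : Integrable (fun ω => W ω * ∑ z, Y ω z ^ (2 * r + 2)) μ :=
      (IsBddMeasurable.sum Finset.univ fun z => (hYb z).pow (2 * r + 2)).integrable_mul hWi
    -- t ≤ 1 + t^(r+1) with t = (n+1)‖Y‖²; the power (n+1)^(r+1) is exactly the rate of the high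
    -- moment.
    have hpath : ∀ ω, ((n : ℝ) + 1) * (W ω * ‖Y ω‖ ^ 2)
        ≤ W ω + ((n : ℝ) + 1) ^ (r + 1) * (W ω * ∑ z, Y ω z ^ (2 * r + 2)) := by
      intro ω
      have : Nonempty (S × U) := ⟨(X 0 ω, A 0 ω)⟩
      have ht : 0 ≤ ((n : ℝ) + 1) * ‖Y ω‖ ^ 2 := by positivity
      have h1 : ((n : ℝ) + 1) * ‖Y ω‖ ^ 2 ≤ 1 + (((n : ℝ) + 1) * ‖Y ω‖ ^ 2) ^ (r + 1) := by
        rcases le_total (((n : ℝ) + 1) * ‖Y ω‖ ^ 2) 1 with h | h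
        · linarith [pow_nonneg ht (r + 1)]
        · linarith [le_self_pow₀ h (by omega : r + 1 ≠ 0)]
      have h2 : (((n : ℝ) + 1) * ‖Y ω‖ ^ 2) ^ (r + 1)
          ≤ ((n : ℝ) + 1) ^ (r + 1) * ∑ z, Y ω z ^ (2 * r + 2) := by
        rw [mul_pow, ← pow_mul, show 2 * (r + 1) = 2 * r + 2 by ring]
        exact mul_le_mul_of_nonneg_left (norm_pow_le_sum_pow r _) (by positivity)
      have h3 := mul_le_mul_of_nonneg_left (h1.trans (add_le_add_right h2 1)) (hW0 ω)
      linarith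
    have hint := integral_mono (hi.const_mul ((n : ℝ) + 1))
      (hWi.add (hAi.const_mul (((n : ℝ) + 1) ^ (r + 1)))) hpath
    rw [integral_add' hWi (hAi.const_mul _), integral_const_mul, integral_const_mul] at hint
    have h4 := H μ X A Q₀ htraj hQ n
    rw [le_div_iff₀ (by positivity)] at h4
    change weightedMoment μ W r Y * _ ≤ _ at h4
    change _ ≤ _ + _ * weightedMoment μ W r Y at hint
    rw [le_div_iff₀ hn]
    linarith

end Rate

theorem mainTheorem5
    {S U : Type*} [Fintype S] [Fintype U] [DecidableEq S] [DecidableEq U]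
    [MeasurableSpace S] [MeasurableSingletonClass S]
    [MeasurableSpace U] [MeasurableSingletonClass U]
    (P : TransitionKernel S U) (Φ : SamplingPolicy S U)
    (hirr : (policyMatrix P Φ).IsIrreducible)
    (γ : ℝ) (hγ : γ ∈ Set.Ioo (0 : ℝ) 1) :
    ∃ C₄ : ℝ, 0 < C₄ ∧ ∃ n₀ : ℕ,
      ∀ (k : S × U → ℝ) (α₀ β₀ : ℝ), 0 < α₀ → β₀ / α₀ ≤ C₄ → 8 ≤ β₀ →
      ∀ R : ℝ, ∃ C : ℝ,
      ∀ {Ω : Type*} [MeasurableSpace Ω] (μ : Measure Ω) [IsProbabilityMeasure μ]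
        (X : ℕ → Ω → S) (A : ℕ → Ω → U) (Q₀ Qbar₀ : Ω → S × U → ℝ),
        IsSampleTrajectory μ P Φ X A Q₀ →
        MemLp Q₀ 2 μ → MemLp Qbar₀ 2 μ →
        ∫ ω, ‖Q₀ ω‖ ^ 2 ∂μ ≤ R → ∫ ω, ‖Qbar₀ ω‖ ^ 2 ∂μ ≤ R →
        ∀ n : ℕ, n₀ ≤ n →
          Integrable
            (fun ω => ‖averagedQ k γ α₀ β₀ X A Q₀ Qbar₀ n ω - optimalQ P k γ hγ‖ ^ 2) μ ∧
          ∫ ω, ‖averagedQ k γ α₀ β₀ X A Q₀ Qbar₀ n ω - optimalQ P k γ hγ‖ ^ 2 ∂μ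
            ≤ C / ((n : ℝ) + 1) := by
  obtain ⟨a, ha, H⟩ := exists_qLearning_rate P Φ hirr γ hγ
  -- 8 ≤ β₀ ≤ (8/a) α₀ gives a ≤ α₀. Early times are absorbed in the constant, so no waiting time is
  -- needed.
  refine ⟨8 / a, by positivity, 0, fun k α₀ β₀ hα₀ hratio hβ₀ R => ?_⟩
  have haα : a ≤ α₀ := by
    rw [div_le_div_iff₀ hα₀ ha] at hratio
    nlinarith
  obtain ⟨C, hC, hrate⟩ := H k α₀ haα
  -- The two bounds come from (x + y)² ≤ 2x² + 2y², applied to 1 + ‖Q₀‖ and to the initial averaged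
  -- error; |R| keeps them nonnegative for every real R.
  obtain ⟨D, hD⟩ := exists_average_bound (β₀ := β₀) (K := C * (2 + 2 * |R|))
    (R := 2 * |R| + 2 * ‖optimalQ P k γ hγ‖ ^ 2) (by linarith) (by positivity) (by positivity)
  refine ⟨D, fun {Ω} _ μ _ X A Q₀ Qbar₀ htraj hQ hQbar hR hRbar n _ => ?_⟩
  have hsq : ∀ {Q : Ω → S × U → ℝ}, MemLp Q 2 μ → Integrable (fun ω => ‖Q ω‖ ^ 2) μ := fun h =>
    h.integrable_norm_pow two_ne_zero
  have htwo : ∀ x y : ℝ, (x + y) ^ 2 ≤ 2 * x ^ 2 + 2 * y ^ 2 := fun x y => by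
    nlinarith [sq_nonneg (x - y)]
  have hW : ∫ ω, (1 + ‖Q₀ ω‖) ^ 2 ∂μ ≤ 2 + 2 * |R| := by
    have h : ∫ ω, (1 + ‖Q₀ ω‖) ^ 2 ∂μ ≤ ∫ ω, (2 + 2 * ‖Q₀ ω‖ ^ 2) ∂μ :=
      integral_mono (memLp_two_integrable_weight hQ)
        ((integrable_const _).add ((hsq hQ).const_mul 2)) fun ω =>
          (htwo 1 ‖Q₀ ω‖).trans (by norm_num)
    rw [integral_add (integrable_const _) ((hsq hQ).const_mul 2), integral_const_mul] at h
    simp only [integral_const, probReal_univ, one_smul] at h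
    linarith [le_abs_self R]
  have hd0 : MemLp (fun ω => Qbar₀ ω - optimalQ P k γ hγ) 2 μ := hQbar.sub (memLp_const _)
  have hd0R : ∫ ω, ‖Qbar₀ ω - optimalQ P k γ hγ‖ ^ 2 ∂μ
      ≤ 2 * |R| + 2 * ‖optimalQ P k γ hγ‖ ^ 2 := by
    have h : ∫ ω, ‖Qbar₀ ω - optimalQ P k γ hγ‖ ^ 2 ∂μ
        ≤ ∫ ω, (2 * ‖Qbar₀ ω‖ ^ 2 + 2 * ‖optimalQ P k γ hγ‖ ^ 2) ∂μ :=
      integral_mono (hsq hd0) (((hsq hQbar).const_mul 2).add (integrable_const _)) fun ω =>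
        (pow_le_pow_left₀ (norm_nonneg _) (norm_sub_le _ _) 2).trans (htwo _ _)
    rw [integral_add ((hsq hQbar).const_mul 2) (integrable_const _), integral_const_mul] at h
    simp only [integral_const, probReal_univ, one_smul] at h
    linarith [le_abs_self R]
  exact hD μ (fun n ω => qLearning k γ α₀ (fun m => X m ω) (fun m => A m ω) (Q₀ ω) n
      - optimalQ P k γ hγ)
    (fun n ω => averagedQ k γ α₀ β₀ X A Q₀ Qbar₀ n ω - optimalQ P k γ hγ)
    (fun m => (hrate μ X A Q₀ htraj hQ m).1) hd0
    (fun m ω => by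
      ext z
      simp only [averagedQ, polyakAverage, Pi.sub_apply, Pi.add_apply, Pi.smul_apply, smul_eq_mul]
      ring)
    (fun m => (hrate μ X A Q₀ htraj hQ m).2.trans (by gcongr)) hd0R n
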